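/- **Calculus.** Data values are $v ::= \bot \mid 0,1,2,\dots \mid (v,v) \mid \{v,\dots,v\}$; variable patterns are $X ::= x \mid (X,X)$; expressions are built from values, variables, pairing and function application; $[\![e]\!]$ is the value of a closed expression $e$. Guarded processes are $G ::= 0 \mid \bar c\langle e\rangle.P \mid c(X).P \mid \mathrm{susp}_k.P \mid \mathrm{psusp}_k.P \mid G+G \mid \text{if } e \text{ then } P \text{ else } Q$, processes are $P ::= \tau.P \mid G \mid K(e) \mid P\,|\,P$ with defining equations $K(X)=P$, networks are $M ::= 0 \mid \ell[P] \mid M\,|\,M \mid M\backslash a$. Locations are agents and a special location $\star$. A configuration $\Gamma\triangleright_{t} M$ has $\Gamma=(L,m)$ with $L$ a finite set of (live) agents and $m\in\mathbb N$ the number of crashes still allowed, a trusted immortal $t$ which is an agent or not yet chosen, and a network $M$. A location $\ell$ is live if $\ell\in L$ or $\ell=\star$. *Evaluation* $>$ keeps $\Gamma,t$, is closed under $|$ and restriction, and is generated, for live $\ell$, by $\ell[P|Q]>\ell[P]\,|\,\ell[Q]$, $\ell[0]>0$, $\ell[\bar c\langle e\rangle.P]>\ell[\bar c\langle[\![e]\!]\rangle.P]$,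 $\ell[K(e)]>\ell[P\{[\![e]\!]/X\}]$ if $K(X)=P$ is a definition, $\ell[\text{if }e\text{ then }P\text{ else }Q]>\ell[P]$ if $[\![e]\!]>0$ and $>\ell[Q]$ if $[\![e]\!]=0$; by $\ell[P]>0$ for $\ell$ not live; and by $0|N>N$, $N|0>N$. *Structural congruence* $\equiv$ is the least equivalence containing $>$ and the commutative monoid laws for $(|,0)$, closed under $|$ and restriction. *Transitions* $\xrightarrow{\alpha}$, with $\alpha ::= \tau\mid \bar c\langle v\rangle\mid c(v)$, are the least relation with: (TI) if $t$ is not chosen, $\Gamma\triangleright M\xrightarrow{\tau}\Gamma\triangleright_t M$ for any $t\in L$; and, once $t$ is chosen: (Stop) $(L,m+1)\triangleright_t M\xrightarrow{\tau}(L\setminus\{\ell\},m)\triangleright_t M$ for $\ell\in L$, $\ell\ne t$; for live $\ell$: (PSusp) $\ell[\mathrm{psusp}_k.P]\xrightarrow{\tau}\ell[P]$ if $k$ is not live, (Susp) $\ell[\mathrm{susp}_k.P]\xrightarrow{\tau}\ell[P]$ if $k\ne t$, $k\neq\ell$, (Tau) $\ell[\tau.P]\xrightarrow{\tau}\ell[P]$,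 (Snd) $\ell[\bar c\langle v\rangle.0]\xrightarrow{\bar c\langle v\rangle}0$, (Rcv) $\ell[c(X).P]\xrightarrow{c(v)}\ell[P\{v/X\}]$, (Sum) if $\Gamma\triangleright_t\ell[G_i]\xrightarrow{\alpha}\Gamma\triangleright_t\ell[P]$ with the same $\Gamma$ on both sides for $i=1$ or $i=2$, then $\Gamma\triangleright_t\ell[G_1+G_2]\xrightarrow{\alpha}\Gamma\triangleright_t\ell[P]$; (Par) closure under $M\mapsto M|N$; (Com) $M\xrightarrow{\alpha}M'$ and $N\xrightarrow{\bar\alpha}N'$ with $\alpha\ne\tau$ and unchanged $\Gamma$ give $M|N\xrightarrow{\tau}M'|N'$; (Res) closure under $M\mapsto M\backslash a$ for actions not on $a$; (Red) closure under $\equiv$ on both sides. **Algorithm.** Fix $n\ge1$ and arbitrary total functions $\mathrm{updk},\mathrm{updr},\mathrm{correct},\mathrm{fst}$ on data values. Write $c?(x)_i.P$ for $c(x).P+\mathrm{susp}_i.P\{\bot/x\}$, and write an output $\bar c\langle e\rangle.0$ as $\bar c\langle e\rangle$. For $1\le p\le n$ the definitions are - $P1_p(r,V,W,M)=$ if $r<n$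 then $\prod_{i=1}^n\bar a_{p,i,r}\langle W\rangle\,|\,C1_p(r,V,M,1)$ else $P2_p(V,M)$; - $C1_p(r,V,M,i)=$ if $i\le n$ then $a_{i,p,r}?(y)_i.C1_p(r,V,M\cup\{(y,r,i)\},i+1)$ else $P1_p(r+1,\mathrm{updk}(r,M,V),\mathrm{updr}(r,M,V),M)$; - $P2_p(V,M)=\prod_{i=1}^n\bar b_{p,i}\langle V\rangle\,|\,C2_p(V,M,1)$; - $C2_p(V,M,i)=$ if $i\le n$ then $b_{i,p}?(y)_i.C2_p(V,M\cup\{(y,i)\},i+1)$ else $P3_p(\mathrm{correct}(M,V))$; - $P3_p(V)=\bar c_p\langle\mathrm{fst}(V)\rangle$; - $\mathrm{Wrap}(i,v,b)=$ if $b=1$ then [if $1\le i\le n$ then $\mathrm{psusp}_i.\mathrm{Wrap}(i+1,v,1)+c_i(y).(\text{if }(v=\bot\wedge y\neq\bot)\vee v=y\text{ then }\mathrm{Wrap}(i+1,y,1)\text{ else }\mathrm{Wrap}(i,v,0))$ else if $i=n+1$ then $\overline{ok}\langle\bot\rangle$ else $0$] else $\mathrm{Wrap}(i,v,0)$. Let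 $R$ consist of all channels $a_{p,i,r}$, $b_{p,i}$, $c_p$ with $1\le p,i\le n$, $1\le r<n$. The initial configurations are $$(\{1,\dots,n\},n-1)\triangleright\Big(\prod_{i=1}^n i[P1_i(1,I^0_i,I_i,\emptyset)]\,|\,\star[\mathrm{Wrap}(1,\bot,1)]\Big)\backslash R$$ with $t$ not chosen, where $I_i$ is the $n$-vector with entry $v_i$ (the natural number proposed by $i$) at position $i$ and $\bot$ elsewhere, and $I_i^0$ is $I_i$ with each entry paired with $0$. A configuration is *reachable* if its trusted immortal is chosen and it is obtained from some initial configuration by finitely many transitions. **Normal forms.** A *normal form* of a reachable configuration $C$ is a configuration structurally congruent to $C$ of the form $$\Gamma\triangleright_t\Big(\prod_{(p,i,r)\in O_1}p[\bar a_{p,i,r}\langle W_{p,r}\rangle]\,|\prod_{(p,i)\in O_2}p[\bar b_{p,i}\langle V^2_p\rangle]\,|\prod_{p\in O_3}p[\bar c_p\langle V^3_p\rangle]\,|\prod_{(p,r)\in A_1}p[C1_p(r,V^1_p,M^1_p,I^1_p)]\,|\prod_{p\in A_2}p[C2_p(V^2_p,M^2_p,I^2_p)]\,|\,\star[\mathrm{Wrap}(j,w,b)]\Big)\backslash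 R$$ with finite index sets, all occurring $p$ live agents, all occurring $i\in\{1,\dots,n\}$, $1\le r<n$, $1\le I^1_p\le n$ for $(p,r)\in A_1$, $1\le I^2_p\le n$ for $p\in A_2$, $0\le j\le n+1$, and $b\in\{0,1\}$. **Theorem.** If $C\xrightarrow{\tau}C'$ and $C$ has a normal form, then $C'$ also has a normal form. -/

import Mathlib

/-! ## Data values -/

/-- Representations of data values `⊥`, `0, 1, 2, …`, `(v, v)`, `{v, …, v}`;
a finite set is listed by its elements. -/
inductive PreVal : Type
  | bot : PreVal
  | nat : ℕ → PreVal
  | pair : PreVal → PreVal → PreVal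
  | set : List PreVal → PreVal

/-- Two representations denote the same value: lists of elements are compared as sets
(every entry of either list has an equivalent entry in the other one). -/
inductive PreVal.Eqv : PreVal → PreVal → Prop
  | bot : PreVal.Eqv PreVal.bot PreVal.bot
  | nat (k : ℕ) : PreVal.Eqv (PreVal.nat k) (PreVal.nat k)
  | pair {v v' w w' : PreVal} : PreVal.Eqv v v' → PreVal.Eqv w w' →
      PreVal.Eqv (PreVal.pair v w) (PreVal.pair v' w')
  | set {l l' : List PreVal} (f g : PreVal → PreVal)
      (hf : ∀ x ∈ l, f x ∈ l') (hg : ∀ y ∈ l', g y ∈ l)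
      (ef : ∀ x ∈ l, PreVal.Eqv x (f x)) (eg : ∀ y ∈ l', PreVal.Eqv (g y) y) :
      PreVal.Eqv (PreVal.set l) (PreVal.set l')

theorem PreVal.Eqv.refl : ∀ v : PreVal, PreVal.Eqv v v
  | .bot => .bot
  | .nat k => .nat k
  | .pair v w => .pair (PreVal.Eqv.refl v) (PreVal.Eqv.refl w)
  | .set l => .set id id (fun _ h => h) (fun _ h => h)
      (fun x _ => PreVal.Eqv.refl x) (fun x _ => PreVal.Eqv.refl x)

/-- Data values. -/
def Val : Type := Quot PreVal.Eqv

namespace Val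

def bot : Val := Quot.mk _ PreVal.bot

def nat (k : ℕ) : Val := Quot.mk _ (PreVal.nat k)

def pair : Val → Val → Val :=
  Quot.map₂ PreVal.pair
    (fun v _ _ h => PreVal.Eqv.pair (PreVal.Eqv.refl v) h)
    (fun _ _ w h => PreVal.Eqv.pair h (PreVal.Eqv.refl w))

/-- The empty set. -/
def empty : Val := Quot.mk _ (PreVal.set [])

/-- The two components of a pair. -/
def unpair : Val → Option (Val × Val) :=
  Quot.lift
    (fun v => match v with
      | PreVal.pair a b => some (Quot.mk _ a, Quot.mk _ b)
      | _ => none)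
    (by
      intro a b h
      cases h with
      | bot => rfl
      | nat k => rfl
      | pair h1 h2 => simp only [Quot.sound h1, Quot.sound h2]
      | set => rfl)

/-- The number that a value is, if it is one. -/
def nat? : Val → Option ℕ :=
  Quot.lift
    (fun v => match v with
      | PreVal.nat k => some k
      | _ => none)
    (by intro a b h; cases h <;> rfl)

/-- `insert x M` is `M ∪ {x}` (a value `M` that is not a set is left unchanged). -/
def insert : Val → Val → Val :=
  Quot.map₂
    (fun x M => match M with
      | PreVal.set l => PreVal.set (x :: l)
      | M => M)
    (by
      intro x a b h
      cases h with
      | bot => exact .bot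
      | nat k => exact .nat k
      | pair h1 h2 => exact .pair h1 h2
      | @set l l' f g hf hg ef eg =>
        classical
        refine .set (fun y => if y ∈ l then f y else y) (fun y => if y ∈ l' then g y else y)
          ?_ ?_ ?_ ?_
        · intro y hy
          by_cases hl : y ∈ l
          · simp [hl, hf y hl]
          · have : y = x := by simpa [hl] using hy
            subst this; simp [hl]
        · intro y hy
          by_cases hl : y ∈ l'
          · simp [hl, hg y hl]
          · have : y = x := by simpa [hl] using hy
            subst this; simp [hl]
        · intro y hy
          by_cases hl : y ∈ l
          · simpa [hl] using ef y hl
          · simpa [hl] using PreVal.Eqv.refl y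
        · intro y hy
          by_cases hl : y ∈ l'
          · simpa [hl] using eg y hl
          · simpa [hl] using PreVal.Eqv.refl y)
    (by
      intro x y M h
      cases M with
      | bot => exact .bot
      | nat k => exact .nat k
      | pair v w => exact PreVal.Eqv.refl _
      | set l =>
        classical
        refine .set (fun z => if z ∈ l then z else y) (fun z => if z ∈ l then z else x)
          ?_ ?_ ?_ ?_
        · intro z hz
          by_cases hl : z ∈ l <;> simp [hl]
        · intro z hz
          by_cases hl : z ∈ l <;> simp [hl]
        · intro z hz
          by_cases hl : z ∈ l
          · simpa [hl] using PreVal.Eqv.refl z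
          · have : z = x := by simpa [hl] using hz
            subst this; simpa [hl] using h
        · intro z hz
          by_cases hl : z ∈ l
          · simpa [hl] using PreVal.Eqv.refl z
          · have : z = y := by simpa [hl] using hz
            subst this; simpa [hl] using h)

/-- Tuples and vectors are iterated pairs. -/
def tuple : List Val → Val
  | [] => bot
  | [v] => v
  | v :: w :: vs => pair v (tuple (w :: vs))

@[simp] theorem unpair_pair (v w : Val) : (pair v w).unpair = some (v, w) := by
  induction v using Quot.ind
  induction w using Quot.ind
  rfl

@[simp] theorem nat?_nat (k : ℕ) : (nat k).nat? = some k := rfl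

end Val

/-! ## Syntax of the calculus -/

/-- The data functions of the algorithm; their interpretation is a parameter. -/
inductive DataFn : Type
  | updateKnowledge | updateReplay | correct | getFirst

/-- Function names. -/
inductive Fn : Type
  | add | le | lt | eq | and | or | not
  | insert
  | data (g : DataFn)

namespace Fn

/-- A binary operation on numbers as a function of a pair (`⊥` on other arguments). -/
def onNats (g : ℕ → ℕ → ℕ) (v : Val) : Val :=
  ((v.unpair.bind fun ab => ab.1.nat?.bind fun a => ab.2.nat?.map fun b =>
    Val.nat (g a b)).getD Val.bot)

/-- A binary operation on values as a function of a pair (`⊥` on other arguments). -/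
def onVals (g : Val → Val → Val) (v : Val) : Val :=
  (v.unpair.map fun ab => g ab.1 ab.2).getD Val.bot

open Classical in
/-- The meaning of the function names; truth values are the numbers `1` and `0`. -/
noncomputable def interp (F : DataFn → Val → Val) : Fn → Val → Val
  | add => onNats fun a b => a + b
  | le => onNats fun a b => if a ≤ b then 1 else 0
  | lt => onNats fun a b => if a < b then 1 else 0
  | eq => onVals fun a b => if a = b then Val.nat 1 else Val.nat 0
  | and => onNats fun a b => if 0 < a ∧ 0 < b then 1 else 0
  | or => onNats fun a b => if 0 < a ∨ 0 < b then 1 else 0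
  | not => fun v => ((v.nat?.map fun a => Val.nat (if a = 0 then 1 else 0)).getD Val.bot)
  | insert => onVals Val.insert
  | data g => F g

end Fn

/-- Variable names. -/
abbrev VarName : Type := ℕ

/-- Variable patterns. -/
inductive Pat : Type
  | var : VarName → Pat
  | pair : Pat → Pat → Pat

/-- Expressions. -/
inductive Expr : Type
  | val : Val → Expr
  | var : VarName → Expr
  | pair : Expr → Expr → Expr
  | app : Fn → Expr → Expr

/-- Locations: the location `⋆` of the wrapper and the agents. -/
inductive Loc : Type
  | star : Loc
  | agent : ℕ → Loc

/-- A subscript of a channel name. -/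
inductive Index : Type
  | num : ℕ → Index
  | var : VarName → Index

/-- The subscript of a suspicion prefix. -/
inductive LocRef : Type
  | loc : Loc → LocRef
  | var : VarName → LocRef

/-- Channel names, with subscripts. -/
structure Chan : Type where
  base : ℕ
  subs : List Index

/-- Names of the process constants. -/
inductive Const : Type
  | P1 (p : ℕ) | C1 (p : ℕ) | P2 (p : ℕ) | C2 (p : ℕ) | P3 (p : ℕ) | wrap

mutual
  /-- Guarded processes: `0`, output, input, suspicion (`susp k`), perfect suspicion
  (`psusp k`), choice, conditional. -/
  inductive Guarded : Type
    | nil : Guarded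
    | out : Chan → Expr → Proc → Guarded
    | inp : Chan → Pat → Proc → Guarded
    | susp : LocRef → Proc → Guarded
    | psusp : LocRef → Proc → Guarded
    | sum : Guarded → Guarded → Guarded
    | ite : Expr → Proc → Proc → Guarded
  /-- Processes: `τ.P`, guarded processes, calls `K(e)`, parallel composition. -/
  inductive Proc : Type
    | tau : Proc → Proc
    | guard : Guarded → Proc
    | call : Const → Expr → Proc
    | par : Proc → Proc → Proc
end

/-- Networks: `0`, located processes, parallel composition, restriction. -/
inductive Net : Type
  | nil : Net
  | loc : Loc → Proc → Net
  | par : Net → Net → Net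
  | res : Net → Chan → Net

/-! ## Evaluation of expressions and substitution -/

/-- The value of an expression; it exists exactly if no variable occurs. -/
noncomputable def Expr.eval (F : DataFn → Val → Val) : Expr → Option Val
  | .val v => some v
  | .var _ => none
  | .pair e₁ e₂ => (e₁.eval F).bind fun v => (e₂.eval F).map fun w => Val.pair v w
  | .app f e => (e.eval F).map (f.interp F)

/-- Substitutions of values for variables. -/
abbrev Subst : Type := VarName → Option Val

namespace Pat

/-- The variables of a pattern. -/
def vars : Pat → List VarName
  | .var x => [x]
  | .pair X Y => X.vars ++ Y.vars

/-- The substitution `{v/X}`; it exists if the shape of the value `v` matches `X`. -/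
def bind : Pat → Val → Option Subst
  | .var x, v => some fun y => if y = x then some v else none
  | .pair X Y, v => v.unpair.bind fun ab =>
      (X.bind ab.1).bind fun σ => (Y.bind ab.2).map fun ρ y => (ρ y).or (σ y)

/-- The pattern `(x, (y, …))`. -/
def tuple : List VarName → Pat
  | [] => .var 0
  | [x] => .var x
  | x :: y :: xs => .pair (.var x) (tuple (y :: xs))

end Pat

namespace Expr

def subst (σ : Subst) : Expr → Expr
  | .val v => .val v
  | .var x => match σ x with
    | some v => .val v
    | none => .var x
  | .pair e₁ e₂ => .pair (e₁.subst σ) (e₂.subst σ)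
  | .app f e => .app f (e.subst σ)

def nat (k : ℕ) : Expr := .val (Val.nat k)

/-- The expression `f(e₁, e₂)`. -/
def app₂ (f : Fn) (e₁ e₂ : Expr) : Expr := .app f (.pair e₁ e₂)

/-- The expression `(e₁, (e₂, …))`. -/
def tuple : List Expr → Expr
  | [] => .val Val.bot
  | [e] => e
  | e :: e' :: es => .pair e (tuple (e' :: es))

end Expr

def Index.subst (σ : Subst) : Index → Index
  | .num k => .num k
  | .var x => match (σ x).bind Val.nat? with
    | some k => .num k
    | none => .var x

def LocRef.subst (σ : Subst) : LocRef → LocRef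
  | .loc ℓ => .loc ℓ
  | .var x => match (σ x).bind Val.nat? with
    | some k => .loc (.agent k)
    | none => .var x

def Chan.subst (σ : Subst) (c : Chan) : Chan := ⟨c.base, c.subs.map (Index.subst σ)⟩

/-- The substitution `σ` without the variables of `X`. -/
def Subst.erase (σ : Subst) (X : Pat) : Subst := fun x => if x ∈ X.vars then none else σ x

mutual
  def Guarded.subst : Subst → Guarded → Guarded
    | _, .nil => .nil
    | σ, .out c e P => .out (c.subst σ) (e.subst σ) (P.subst σ)
    | σ, .inp c X P => .inp (c.subst σ) X (P.subst (σ.erase X))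
    | σ, .susp k P => .susp (k.subst σ) (P.subst σ)
    | σ, .psusp k P => .psusp (k.subst σ) (P.subst σ)
    | σ, .sum G₁ G₂ => .sum (G₁.subst σ) (G₂.subst σ)
    | σ, .ite e P Q => .ite (e.subst σ) (P.subst σ) (Q.subst σ)
  def Proc.subst : Subst → Proc → Proc
    | σ, .tau P => .tau (P.subst σ)
    | σ, .guard G => .guard (G.subst σ)
    | σ, .call K e => .call K (e.subst σ)
    | σ, .par P Q => .par (P.subst σ) (Q.subst σ)
end

namespace Proc

/-- The process `0`. -/
def nil : Proc := .guard .nil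

/-- Output without continuation. -/
def out (c : Chan) (e : Expr) : Proc := .guard (.out c e nil)

/-- Finite products of processes. -/
def prod (l : List Proc) : Proc := l.foldr Proc.par nil

end Proc

/-- `c(x).P + susp k . P{⊥/x}`: receive on `c` or suspect `k`. -/
def Guarded.inpat (c : Chan) (x : VarName) (k : LocRef) (P : Proc) : Guarded :=
  .sum (.inp c (.var x) P)
    (.susp k (P.subst fun y => if y = x then some Val.bot else none))

/-! ## Configurations, evaluation, structural congruence -/

/-- The part `Γ = (L, n)` of a configuration: the live agents and the number of
locations that may still crash. -/
structure Ctx : Type where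
  live : Finset ℕ
  budget : ℕ

/-- The wrapper location is always live. -/
def Ctx.Live (Γ : Ctx) : Loc → Prop
  | .star => True
  | .agent k => k ∈ Γ.live

/-- Configurations; `ti` is the trusted immortal, `none` as long as it has not been chosen. -/
structure Config : Type where
  ctx : Ctx
  ti : Option ℕ
  net : Net

/-- Finite sets of process definitions `K(X) = P`, as partial functions. -/
abbrev ProcDefs : Type := Const → Option (Pat × Proc)

/-- Network evaluation `>`. It leaves `Γ` and the trusted immortal unchanged. -/
inductive Eval (F : DataFn → Val → Val) (D : ProcDefs) (Γ : Ctx) : Net → Net → Prop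
  | split {ℓ : Loc} {P Q : Proc} (h : Γ.Live ℓ) :
      Eval F D Γ (.loc ℓ (.par P Q)) (.par (.loc ℓ P) (.loc ℓ Q))
  | locNil {ℓ : Loc} (h : Γ.Live ℓ) : Eval F D Γ (.loc ℓ Proc.nil) .nil
  | dead {ℓ : Loc} {P : Proc} (h : ¬ Γ.Live ℓ) : Eval F D Γ (.loc ℓ P) .nil
  | nilLeft {N : Net} : Eval F D Γ (.par .nil N) N
  | nilRight {N : Net} : Eval F D Γ (.par N .nil) N
  | outEval {ℓ : Loc} {c : Chan} {e : Expr} {v : Val} {P : Proc} (h : Γ.Live ℓ)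
      (he : e.eval F = some v) :
      Eval F D Γ (.loc ℓ (.guard (.out c e P))) (.loc ℓ (.guard (.out c (.val v) P)))
  | expand {ℓ : Loc} {K : Const} {e : Expr} {X : Pat} {P : Proc} {v : Val} {σ : Subst}
      (h : Γ.Live ℓ) (hK : D K = some (X, P)) (he : e.eval F = some v)
      (hσ : X.bind v = some σ) :
      Eval F D Γ (.loc ℓ (.call K e)) (.loc ℓ (P.subst σ))
  | iteTrue {ℓ : Loc} {e : Expr} {k : ℕ} {P Q : Proc} (h : Γ.Live ℓ)
      (he : e.eval F = some (Val.nat k)) (hk : 0 < k) :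
      Eval F D Γ (.loc ℓ (.guard (.ite e P Q))) (.loc ℓ P)
  | iteFalse {ℓ : Loc} {e : Expr} {P Q : Proc} (h : Γ.Live ℓ)
      (he : e.eval F = some (Val.nat 0)) :
      Eval F D Γ (.loc ℓ (.guard (.ite e P Q))) (.loc ℓ Q)
  | parLeft {M M' N : Net} (h : Eval F D Γ M M') : Eval F D Γ (.par M N) (.par M' N)
  | parRight {M M' N : Net} (h : Eval F D Γ M M') : Eval F D Γ (.par N M) (.par N M')
  | res {M M' : Net} {a : Chan} (h : Eval F D Γ M M') : Eval F D Γ (.res M a) (.res M' a)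

/-- Structural congruence of networks under `Γ`: the least equivalence relation that contains
evaluation and the commutative monoid laws and is closed under parallel composition and
restriction. -/
inductive NetCong (F : DataFn → Val → Val) (D : ProcDefs) (Γ : Ctx) : Net → Net → Prop
  | refl (M : Net) : NetCong F D Γ M M
  | symm {M N : Net} (h : NetCong F D Γ M N) : NetCong F D Γ N M
  | trans {M N O : Net} (h : NetCong F D Γ M N) (h' : NetCong F D Γ N O) : NetCong F D Γ M O
  | eval {M N : Net} (h : Eval F D Γ M N) : NetCong F D Γ M N
  | parComm (M N : Net) : NetCong F D Γ (.par M N) (.par N M)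
  | parAssoc (M N O : Net) : NetCong F D Γ (.par (.par M N) O) (.par M (.par N O))
  | parNil (M : Net) : NetCong F D Γ (.par M .nil) M
  | par {M M' N N' : Net} (h : NetCong F D Γ M M') (h' : NetCong F D Γ N N') :
      NetCong F D Γ (.par M N) (.par M' N')
  | res {M M' : Net} {a : Chan} (h : NetCong F D Γ M M') : NetCong F D Γ (.res M a) (.res M' a)

/-- Structural congruence `≡` of configurations. -/
def StructCong (F : DataFn → Val → Val) (D : ProcDefs) (C C' : Config) : Prop :=
  C.ctx = C'.ctx ∧ C.ti = C'.ti ∧ NetCong F D C.ctx C.net C'.net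

/-! ## Transitions -/

/-- Actions. -/
inductive Act : Type
  | tau : Act
  | out : Chan → Val → Act
  | inp : Chan → Val → Act

/-- The complementary action. -/
def Act.co : Act → Act
  | .tau => .tau
  | .out c v => .inp c v
  | .inp c v => .out c v

/-- Labelled transitions of configurations. -/
inductive Step (F : DataFn → Val → Val) (D : ProcDefs) : Config → Act → Config → Prop
  | chooseTi {Γ : Ctx} {t : ℕ} {M : Net} (h : t ∈ Γ.live) :
      Step F D ⟨Γ, none, M⟩ .tau ⟨Γ, some t, M⟩
  | crash {L : Finset ℕ} {n t k : ℕ} {M : Net} (hk : k ≠ t) (hL : k ∈ L) :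
      Step F D ⟨⟨L, n + 1⟩, some t, M⟩ .tau ⟨⟨L.erase k, n⟩, some t, M⟩
  | psusp {Γ : Ctx} {t : ℕ} {ℓ k : Loc} {P : Proc} (h : Γ.Live ℓ) (hk : ¬ Γ.Live k) :
      Step F D ⟨Γ, some t, .loc ℓ (.guard (.psusp (.loc k) P))⟩ .tau ⟨Γ, some t, .loc ℓ P⟩
  | susp {Γ : Ctx} {t : ℕ} {ℓ k : Loc} {P : Proc} (h : Γ.Live ℓ) (ht : k ≠ .agent t)
      (hk : k ≠ ℓ) :
      Step F D ⟨Γ, some t, .loc ℓ (.guard (.susp (.loc k) P))⟩ .tau ⟨Γ, some t, .loc ℓ P⟩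
  | tau {Γ : Ctx} {t : ℕ} {ℓ : Loc} {P : Proc} (h : Γ.Live ℓ) :
      Step F D ⟨Γ, some t, .loc ℓ (.tau P)⟩ .tau ⟨Γ, some t, .loc ℓ P⟩
  | sumLeft {Γ : Ctx} {t : ℕ} {ℓ : Loc} {G₁ G₂ : Guarded} {P : Proc} {α : Act}
      (h : Γ.Live ℓ)
      (hs : Step F D ⟨Γ, some t, .loc ℓ (.guard G₁)⟩ α ⟨Γ, some t, .loc ℓ P⟩) :
      Step F D ⟨Γ, some t, .loc ℓ (.guard (.sum G₁ G₂))⟩ α ⟨Γ, some t, .loc ℓ P⟩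
  | sumRight {Γ : Ctx} {t : ℕ} {ℓ : Loc} {G₁ G₂ : Guarded} {P : Proc} {α : Act}
      (h : Γ.Live ℓ)
      (hs : Step F D ⟨Γ, some t, .loc ℓ (.guard G₂)⟩ α ⟨Γ, some t, .loc ℓ P⟩) :
      Step F D ⟨Γ, some t, .loc ℓ (.guard (.sum G₁ G₂))⟩ α ⟨Γ, some t, .loc ℓ P⟩
  | par {Γ Γ' : Ctx} {t : ℕ} {M M' N : Net} {α : Act}
      (hs : Step F D ⟨Γ, some t, M⟩ α ⟨Γ', some t, M'⟩) :
      Step F D ⟨Γ, some t, .par M N⟩ α ⟨Γ', some t, .par M' N⟩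
  | snd {Γ : Ctx} {t : ℕ} {ℓ : Loc} {c : Chan} {v : Val} (h : Γ.Live ℓ) :
      Step F D ⟨Γ, some t, .loc ℓ (Proc.out c (.val v))⟩ (.out c v) ⟨Γ, some t, .nil⟩
  | rcv {Γ : Ctx} {t : ℕ} {ℓ : Loc} {c : Chan} {X : Pat} {P : Proc} {v : Val} {σ : Subst}
      (h : Γ.Live ℓ) (hσ : X.bind v = some σ) :
      Step F D ⟨Γ, some t, .loc ℓ (.guard (.inp c X P))⟩ (.inp c v)
        ⟨Γ, some t, .loc ℓ (P.subst σ)⟩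
  | com {Γ : Ctx} {t : ℕ} {M M' N N' : Net} {α : Act} (hα : α ≠ .tau)
      (hM : Step F D ⟨Γ, some t, M⟩ α ⟨Γ, some t, M'⟩)
      (hN : Step F D ⟨Γ, some t, N⟩ α.co ⟨Γ, some t, N'⟩) :
      Step F D ⟨Γ, some t, .par M N⟩ .tau ⟨Γ, some t, .par M' N'⟩
  | red {C C₁ C₂ C' : Config} {α : Act} (h : StructCong F D C C₁) (hs : Step F D C₁ α C₂)
      (h' : StructCong F D C₂ C') : Step F D C α C'
  | res {Γ Γ' : Ctx} {t : ℕ} {M M' : Net} {a : Chan} {α : Act}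
      (hs : Step F D ⟨Γ, some t, M⟩ α ⟨Γ', some t, M'⟩)
      (hα : ∀ v : Val, α ≠ .out a v ∧ α ≠ .inp a v) :
      Step F D ⟨Γ, some t, .res M a⟩ α ⟨Γ', some t, .res M' a⟩

/-- Weak `τ`-transitions. -/
def WeakTau (F : DataFn → Val → Val) (D : ProcDefs) : Config → Config → Prop :=
  Relation.ReflTransGen fun C C' => Step F D C .tau C'

/-- Weak transitions along a finite sequence of visible actions. -/
def WeakSeq (F : DataFn → Val → Val) (D : ProcDefs) : List Act → Config → Config → Prop
  | [], C, C' => WeakTau F D C C'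
  | α :: σ, C, C' => ∃ C₁ C₂, WeakTau F D C C₁ ∧ Step F D C₁ α C₂ ∧ WeakSeq F D σ C₂ C'

/-! ## The consensus algorithm -/

namespace Consensus

/-- The channel `a_{p,i,r}`. -/
def chA (p i r : Index) : Chan := ⟨0, [p, i, r]⟩

/-- The channel `b_{p,i}`. -/
def chB (p i : Index) : Chan := ⟨1, [p, i]⟩

/-- The channel `c_p`. -/
def chC (p : Index) : Chan := ⟨2, [p]⟩

/-- The channel `ok`. -/
def chOk : Chan := ⟨3, []⟩

/-! Variables: round `r`, knowledge vector `V`, replay vector `W`, collected messages `M`,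
counter `i`, decided value `v`, flag `b`, received vector or value `y`. -/

def xr : VarName := 0
def xV : VarName := 1
def xW : VarName := 2
def xM : VarName := 3
def xi : VarName := 4
def xv : VarName := 5
def xb : VarName := 6
def xy : VarName := 7

/-- `P1_p(r, V, W, M)`: `if r < n then ∏ᵢ a_{p,i,r}⟨W⟩ ∣ C1_p(r, V, M, 1) else P2_p(V, M)`. -/
def bodyP1 (n p : ℕ) : Proc :=
  .guard (.ite (.app₂ .lt (.var xr) (.nat n))
    (.par
      (Proc.prod ((List.range' 1 n).map fun i =>
        Proc.out (chA (.num p) (.num i) (.var xr)) (.var xW)))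
      (.call (.C1 p) (.tuple [.var xr, .var xV, .var xM, .nat 1])))
    (.call (.P2 p) (.tuple [.var xV, .var xM])))

/-- `C1_p(r, V, M, i)`: if `i ≤ n`, receive `y` on `a_{i,p,r}` or suspect `i`, and continue as
`C1_p(r, V, M + (y, r, i), i + 1)`; else
`P1_p(r + 1, updateKnowledge(r, M, V), updateReplay(r, M, V), M)`. -/
def bodyC1 (n p : ℕ) : Proc :=
  .guard (.ite (.app₂ .le (.var xi) (.nat n))
    (.guard (Guarded.inpat (chA (.var xi) (.num p) (.var xr)) xy (.var xi)
      (.call (.C1 p) (.tuple [.var xr, .var xV,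
        .app₂ .insert (.tuple [.var xy, .var xr, .var xi]) (.var xM),
        .app₂ .add (.var xi) (.nat 1)]))))
    (.call (.P1 p) (.tuple [.app₂ .add (.var xr) (.nat 1),
      .app (.data .updateKnowledge) (.tuple [.var xr, .var xM, .var xV]),
      .app (.data .updateReplay) (.tuple [.var xr, .var xM, .var xV]),
      .var xM])))

/-- `P2_p(V, M)`: `∏ᵢ b_{p,i}⟨V⟩ ∣ C2_p(V, M, 1)`. -/
def bodyP2 (n p : ℕ) : Proc :=
  .par
    (Proc.prod ((List.range' 1 n).map fun i =>
      Proc.out (chB (.num p) (.num i)) (.var xV)))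
    (.call (.C2 p) (.tuple [.var xV, .var xM, .nat 1]))

/-- `C2_p(V, M, i)`: if `i ≤ n`, receive `y` on `b_{i,p}` or suspect `i`, and continue as
`C2_p(V, M + (y, i), i + 1)`; else `P3_p(correct(M, V))`. -/
def bodyC2 (n p : ℕ) : Proc :=
  .guard (.ite (.app₂ .le (.var xi) (.nat n))
    (.guard (Guarded.inpat (chB (.var xi) (.num p)) xy (.var xi)
      (.call (.C2 p) (.tuple [.var xV,
        .app₂ .insert (.tuple [.var xy, .var xi]) (.var xM),
        .app₂ .add (.var xi) (.nat 1)]))))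
    (.call (.P3 p) (.app (.data .correct) (.tuple [.var xM, .var xV]))))

/-- `P3_p(V)`: `c_p⟨getFirst(V)⟩`. -/
def bodyP3 (p : ℕ) : Proc :=
  Proc.out (chC (.num p)) (.app (.data .getFirst) (.var xV))

/-- `wrap(i, v, b)`: if `b = 1` then (if `1 ≤ i ≤ n` then
`psusp i . wrap(i+1, v, 1) + c_i(y). if (v = ⊥ and y ≠ ⊥) or v = y then wrap(i+1, y, 1)
else wrap(i, v, 0)`, else if `i = n + 1` then output on `ok`, else `0`), else `wrap(i, v, 0)`. -/
def bodyWrap (n : ℕ) : Proc :=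
  .guard (.ite (.app₂ .eq (.var xb) (.nat 1))
    (.guard (.ite
      (.app₂ .and (.app₂ .le (.nat 1) (.var xi)) (.app₂ .le (.var xi) (.nat n)))
      (.guard (.sum
        (.psusp (.var xi)
          (.call .wrap (.tuple [.app₂ .add (.var xi) (.nat 1), .var xv, .nat 1])))
        (.inp (chC (.var xi)) (.var xy)
          (.guard (.ite
            (.app₂ .or
              (.app₂ .and (.app₂ .eq (.var xv) (.val Val.bot))
                (.app .not (.app₂ .eq (.var xy) (.val Val.bot))))
              (.app₂ .eq (.var xv) (.var xy)))
            (.call .wrap (.tuple [.app₂ .add (.var xi) (.nat 1), .var xy, .nat 1]))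
            (.call .wrap (.tuple [.var xi, .var xv, .nat 0])))))))
      (.guard (.ite (.app₂ .eq (.var xi) (.nat (n + 1)))
        (Proc.out chOk (.val Val.bot))
        Proc.nil))))
    (.call .wrap (.tuple [.var xi, .var xv, .nat 0])))

/-- The process definitions for `n` agents. -/
def defs (n : ℕ) : ProcDefs
  | .P1 p => if 1 ≤ p ∧ p ≤ n then some (.tuple [xr, xV, xW, xM], bodyP1 n p) else none
  | .C1 p => if 1 ≤ p ∧ p ≤ n then some (.tuple [xr, xV, xM, xi], bodyC1 n p) else none
  | .P2 p => if 1 ≤ p ∧ p ≤ n then some (.tuple [xV, xM], bodyP2 n p) else none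
  | .C2 p => if 1 ≤ p ∧ p ≤ n then some (.tuple [xV, xM, xi], bodyC2 n p) else none
  | .P3 p => if 1 ≤ p ∧ p ≤ n then some (.tuple [xV], bodyP3 p) else none
  | .wrap => some (.tuple [xi, xv, xb], bodyWrap n)

/-- The restricted channels: all `a_{p,i,r}` (`1 ≤ p, i ≤ n`, `1 ≤ r < n`), `b_{p,i}`, `c_p`. -/
def restricted (n : ℕ) : List Chan :=
  ((List.range' 1 n).flatMap fun p => (List.range' 1 n).flatMap fun i =>
    (List.range' 1 (n - 1)).map fun r => chA (.num p) (.num i) (.num r)) ++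
  ((List.range' 1 n).flatMap fun p => (List.range' 1 n).map fun i =>
    chB (.num p) (.num i)) ++
  ((List.range' 1 n).map fun p => chC (.num p))

/-- Restriction of a network by a list of channels. -/
def resAll (R : List Chan) (N : Net) : Net := R.foldr (fun a M => .res M a) N

/-- Finite products of networks. -/
def netProd (l : List Net) : Net := l.foldr Net.par .nil

/-- The vector `I_i` that contains the proposed value `u i` at position `i` and `⊥` elsewhere. -/
def initReplay (n : ℕ) (u : ℕ → ℕ) (i : ℕ) : Val :=
  Val.tuple ((List.range' 1 n).map fun j => if j = i then Val.nat (u i) else Val.bot)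

/-- The vector `I⁰_i`: the entries of `I_i`, each paired with `0`. -/
def initKnowledge (n : ℕ) (u : ℕ → ℕ) (i : ℕ) : Val :=
  Val.tuple ((List.range' 1 n).map fun j =>
    Val.pair (if j = i then Val.nat (u i) else Val.bot) (Val.nat 0))

/-- The process `wrap(j, w, b)`. -/
def wrapCall (j : ℕ) (w : Val) (b : ℕ) : Proc :=
  .call .wrap (.tuple [.nat j, .val w, .nat b])

/-- The initial configuration with `n` agents and proposed values `u 1, …, u n`. -/
def initial (n : ℕ) (u : ℕ → ℕ) : Config where
  ctx := ⟨Finset.Icc 1 n, n - 1⟩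
  ti := none
  net := resAll (restricted n) (.par
    (netProd ((List.range' 1 n).map fun i =>
      .loc (.agent i) (.call (.P1 i) (.tuple [.nat 1, .val (initKnowledge n u i),
        .val (initReplay n u i), .val Val.empty]))))
    (.loc .star (wrapCall 1 Val.bot 1)))

/-- Reachable configurations: the trusted immortal is chosen, and the configuration is reached
by a weak transition sequence from an initial one. -/
def Reachable (F : DataFn → Val → Val) (n : ℕ) (C : Config) : Prop :=
  (∃ t : ℕ, C.ti = some t) ∧
    ∃ u : ℕ → ℕ, ∃ σ : List Act, (∀ α ∈ σ, α ≠ .tau) ∧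
      WeakSeq F (defs n) σ (initial n u) C

/-- The entries of a standard form. Finite index sets are enumerated by lists. -/
structure StdForm : Type where
  ctx : Ctx
  ti : ℕ
  /-- messages of the first phase in transit: `(p, i, r)`, from `p` to `i` in round `r` -/
  out1 : List (ℕ × ℕ × ℕ)
  /-- messages of the second phase in transit: `(p, i)`, from `p` to `i` -/
  out2 : List (ℕ × ℕ)
  /-- decisions in transit -/
  out3 : List ℕ
  /-- agents that collect messages of the first phase, with their rounds: `(p, r)` -/
  col1 : List (ℕ × ℕ)
  /-- agents that collect messages of the second phase -/
  col2 : List ℕ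
  /-- the replay vector sent by `p` in round `r` -/
  W : ℕ → ℕ → Val
  V1 : ℕ → Val
  M1 : ℕ → Val
  I1 : ℕ → ℕ
  V2 : ℕ → Val
  M2 : ℕ → Val
  I2 : ℕ → ℕ
  V3 : ℕ → Val
  wj : ℕ
  ww : Val
  wb : ℕ

namespace StdForm

/-- The configuration described by a standard form. -/
def toConfig (n : ℕ) (S : StdForm) : Config where
  ctx := S.ctx
  ti := some S.ti
  net := resAll (restricted n) (
    .par (netProd (S.out1.map fun x =>
      .loc (.agent x.1)
        (Proc.out (chA (.num x.1) (.num x.2.1) (.num x.2.2)) (.val (S.W x.1 x.2.2)))))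
    (.par (netProd (S.out2.map fun x =>
      .loc (.agent x.1) (Proc.out (chB (.num x.1) (.num x.2)) (.val (S.V2 x.1)))))
    (.par (netProd (S.out3.map fun p =>
      .loc (.agent p) (Proc.out (chC (.num p)) (.val (S.V3 p)))))
    (.par (netProd (S.col1.map fun x =>
      .loc (.agent x.1) (.call (.C1 x.1)
        (.tuple [.nat x.2, .val (S.V1 x.1), .val (S.M1 x.1), .nat (S.I1 x.1)]))))
    (.par (netProd (S.col2.map fun p =>
      .loc (.agent p) (.call (.C2 p)
        (.tuple [.val (S.V2 p), .val (S.M2 p), .nat (S.I2 p)]))))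
    (.loc .star (wrapCall S.wj S.ww S.wb)))))))

/-- `p` is an agent and live. -/
def LiveAgent (n : ℕ) (S : StdForm) (p : ℕ) : Prop :=
  p ∈ Finset.Icc 1 n ∧ p ∈ S.ctx.live

/-- The side conditions of a standard form. The counter of the wrapper is `n + 1` when all
agents have been dealt with, and `0` when the wrapper has terminated. -/
structure Valid (n : ℕ) (S : StdForm) : Prop where
  nodup1 : S.out1.Nodup
  nodup2 : S.out2.Nodup
  nodup3 : S.out3.Nodup
  nodup4 : S.col1.Nodup
  nodup5 : S.col2.Nodup
  out1 : ∀ p i r : ℕ, (p, i, r) ∈ S.out1 →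
    S.LiveAgent n p ∧ i ∈ Finset.Icc 1 n ∧ 1 ≤ r ∧ r < n
  out2 : ∀ p i : ℕ, (p, i) ∈ S.out2 → S.LiveAgent n p ∧ i ∈ Finset.Icc 1 n
  out3 : ∀ p ∈ S.out3, S.LiveAgent n p
  col1 : ∀ p r : ℕ, (p, r) ∈ S.col1 →
    S.LiveAgent n p ∧ 1 ≤ r ∧ r < n ∧ 1 ≤ S.I1 p ∧ S.I1 p ≤ n
  col2 : ∀ p ∈ S.col2, S.LiveAgent n p ∧ 1 ≤ S.I2 p ∧ S.I2 p ≤ n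
  wj : S.wj ≤ n + 1
  wb : S.wb = 0 ∨ S.wb = 1

end StdForm

/-- `N` is a normal form of the reachable configuration `C`. -/
def IsNormalFormOf (F : DataFn → Val → Val) (n : ℕ) (N C : Config) : Prop :=
  Reachable F n C ∧ (∃ S : StdForm, S.Valid n ∧ N = S.toConfig n) ∧ StructCong F (defs n) N C

/-- `C` has a normal form. -/
def HasNormalForm (F : DataFn → Val → Val) (n : ℕ) (C : Config) : Prop :=
  ∃ N : Config, IsNormalFormOf F n N C

end Consensus

/-!
Every reachable configuration whose trusted immortal has been chosen has a normal form; as a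
transition preserves reachability, the theorem follows.

The difficulty is that transitions are closed under structural congruence, which contains
evaluation in both directions. The relation `Fire` avoids this closure: it evaluates a located
process forwards, only as far as the moving component requires. Structural congruence is a
bisimulation for `Fire` (`NetCong.simulates`), and therefore every transition is, up to congruence
of its target, a `Fire` transition or a crash (`Step.of_ti_some`). So it suffices to look at the
`Fire` transitions of one convenient representative of each congruence class.

That representative is a product of *items*: messages in transit, collectors, and the wrapper.
By `Item.next_of_fire` a transition of an item replaces it by other items (`Item.Next`); a
communication does so for two items at once. For the shape of a configuration neither the labels
nor the values exchanged matter. A wrapper whose flag is `0` evaluates to itself for ever and has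
no transition (`wrapCall_flag_zero`), and a wrapper that has announced success is congruent to the
wrapper with counter `0`.

A standard form lists its messages without repetition and stores one value per agent (or per agent
and round) for several components, so the items must be compatible with each other
(`Item.Compat`). The essential point is that an agent has at most one collector, and that an agent
collecting in some round of the first phase has sent no message of a later round or phase; hence
new messages never clash with those still in transit (`Item.Next.compat`). Compatibility is an
invariant of all transitions (`Tame.step`), where a crash only removes the items of one agent, since
structural congruence persists when locations die (`NetCong.mono`). Compatible items can be
collected in a standard form (`Tame.exists_stdForm`).
-/

/-! ### Calculus of structural congruence -/

section Congruence

variable {F : DataFn → Val → Val} {D : ProcDefs} {Γ : Ctx}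

theorem Act.co_co (α : Act) : α.co.co = α := by cases α <;> rfl

theorem Act.co_ne_tau {α : Act} (h : α ≠ .tau) : α.co ≠ .tau := by
  cases α <;> simp_all [Act.co]

namespace NetCong

theorem nilPar (M : Net) : NetCong F D Γ (.par .nil M) M := .eval .nilLeft

theorem parLeft {M M' : Net} (h : NetCong F D Γ M M') (N : Net) :
    NetCong F D Γ (.par M N) (.par M' N) := .par h (.refl N)

theorem parRight (M : Net) {N N' : Net} (h : NetCong F D Γ N N') :
    NetCong F D Γ (.par M N) (.par M N') := .par (.refl M) h

theorem parLeftComm (M N O : Net) :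
    NetCong F D Γ (.par M (.par N O)) (.par N (.par M O)) :=
  (parAssoc M N O).symm.trans ((parLeft (parComm M N) O).trans (parAssoc N M O))

/-- Structural congruence survives crashes: at a location that has crashed, both sides of an
evaluation step are congruent to `0`. -/
theorem mono {Γ' : Ctx} (hΓ : Γ'.live ⊆ Γ.live) {M N : Net} (h : NetCong F D Γ M N) :
    NetCong F D Γ' M N := by
  have live : ∀ {ℓ : Loc}, Γ'.Live ℓ → Γ.Live ℓ := by
    intro ℓ h
    cases ℓ with
    | star => trivial
    | agent k => exact hΓ h
  have both : ∀ {ℓ : Loc} (P Q : Proc), ¬ Γ'.Live ℓ →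
      NetCong F D Γ' (.loc ℓ P) (.loc ℓ Q) :=
    fun P Q h => (NetCong.eval (.dead h)).trans (NetCong.eval (.dead h)).symm
  have ev : ∀ {M N : Net}, Eval F D Γ M N → NetCong F D Γ' M N := by
    intro M N h
    induction h with
    | @split ℓ P Q h =>
      by_cases hl : Γ'.Live ℓ
      · exact .eval (.split hl)
      · exact (NetCong.eval (.dead hl)).trans ((nilPar .nil).symm.trans
          (.par (NetCong.eval (.dead hl)).symm (NetCong.eval (.dead hl)).symm))
    | @locNil ℓ h =>
      by_cases hl : Γ'.Live ℓ
      · exact .eval (.locNil hl)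
      · exact .eval (.dead hl)
    | dead h => exact .eval (.dead fun h' => h (live h'))
    | nilLeft => exact .eval .nilLeft
    | nilRight => exact .eval .nilRight
    | @outEval ℓ c e v P h he =>
      by_cases hl : Γ'.Live ℓ
      · exact .eval (.outEval hl he)
      · exact both _ _ hl
    | @expand ℓ K e X P v σ h hK he hσ =>
      by_cases hl : Γ'.Live ℓ
      · exact .eval (.expand hl hK he hσ)
      · exact both _ _ hl
    | @iteTrue ℓ e k P Q h he hk =>
      by_cases hl : Γ'.Live ℓ
      · exact .eval (.iteTrue hl he hk)
      · exact both _ _ hl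
    | @iteFalse ℓ e P Q h he =>
      by_cases hl : Γ'.Live ℓ
      · exact .eval (.iteFalse hl he)
      · exact both _ _ hl
    | parLeft _ ih => exact parLeft ih _
    | parRight _ ih => exact parRight _ ih
    | res _ ih => exact .res ih
  induction h with
  | refl M => exact .refl M
  | symm _ ih => exact .symm ih
  | trans _ _ ih ih' => exact .trans ih ih'
  | eval h => exact ev h
  | parComm M N => exact .parComm M N
  | parAssoc M N O => exact .parAssoc M N O
  | parNil M => exact .parNil M
  | par _ _ ih ih' => exact .par ih ih'
  | res _ ih => exact .res ih

end NetCong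

end Congruence

/-! ### Transitions that evaluate on demand -/

/-- `Fire F D Γ t M α N`: the transitions `Γ ▷_t M -α-> Γ ▷_t N` other than crashes, generated
without closure under structural congruence. Instead, a located process is evaluated, forwards
only, until the component that moves is exposed. -/
inductive Fire (F : DataFn → Val → Val) (D : ProcDefs) (Γ : Ctx) (t : ℕ) :
    Net → Act → Net → Prop
  | psusp {ℓ k : Loc} {P : Proc} (h : Γ.Live ℓ) (hk : ¬ Γ.Live k) :
      Fire F D Γ t (.loc ℓ (.guard (.psusp (.loc k) P))) .tau (.loc ℓ P)
  | susp {ℓ k : Loc} {P : Proc} (h : Γ.Live ℓ) (ht : k ≠ .agent t) (hk : k ≠ ℓ) :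
      Fire F D Γ t (.loc ℓ (.guard (.susp (.loc k) P))) .tau (.loc ℓ P)
  | tau {ℓ : Loc} {P : Proc} (h : Γ.Live ℓ) : Fire F D Γ t (.loc ℓ (.tau P)) .tau (.loc ℓ P)
  | sumLeft {ℓ : Loc} {G₁ G₂ : Guarded} {N : Net} {α : Act} (h : Γ.Live ℓ)
      (hs : Fire F D Γ t (.loc ℓ (.guard G₁)) α N) :
      Fire F D Γ t (.loc ℓ (.guard (.sum G₁ G₂))) α N
  | sumRight {ℓ : Loc} {G₁ G₂ : Guarded} {N : Net} {α : Act} (h : Γ.Live ℓ)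
      (hs : Fire F D Γ t (.loc ℓ (.guard G₂)) α N) :
      Fire F D Γ t (.loc ℓ (.guard (.sum G₁ G₂))) α N
  | snd {ℓ : Loc} {c : Chan} {e : Expr} {v : Val} (h : Γ.Live ℓ) (he : e.eval F = some v) :
      Fire F D Γ t (.loc ℓ (.guard (.out c e Proc.nil))) (.out c v) .nil
  | rcv {ℓ : Loc} {c : Chan} {X : Pat} {P : Proc} {v : Val} {σ : Subst} (h : Γ.Live ℓ)
      (hσ : X.bind v = some σ) :
      Fire F D Γ t (.loc ℓ (.guard (.inp c X P))) (.inp c v) (.loc ℓ (P.subst σ))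
  | split {ℓ : Loc} {P Q : Proc} {N : Net} {α : Act} (h : Γ.Live ℓ)
      (hs : Fire F D Γ t (.par (.loc ℓ P) (.loc ℓ Q)) α N) :
      Fire F D Γ t (.loc ℓ (.par P Q)) α N
  | expand {ℓ : Loc} {K : Const} {e : Expr} {X : Pat} {P : Proc} {v : Val} {σ : Subst}
      {N : Net} {α : Act} (h : Γ.Live ℓ) (hK : D K = some (X, P)) (he : e.eval F = some v)
      (hσ : X.bind v = some σ) (hs : Fire F D Γ t (.loc ℓ (P.subst σ)) α N) :
      Fire F D Γ t (.loc ℓ (.call K e)) α N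
  | iteTrue {ℓ : Loc} {e : Expr} {k : ℕ} {P Q : Proc} {N : Net} {α : Act} (h : Γ.Live ℓ)
      (he : e.eval F = some (Val.nat k)) (hk : 0 < k) (hs : Fire F D Γ t (.loc ℓ P) α N) :
      Fire F D Γ t (.loc ℓ (.guard (.ite e P Q))) α N
  | iteFalse {ℓ : Loc} {e : Expr} {P Q : Proc} {N : Net} {α : Act} (h : Γ.Live ℓ)
      (he : e.eval F = some (Val.nat 0)) (hs : Fire F D Γ t (.loc ℓ Q) α N) :
      Fire F D Γ t (.loc ℓ (.guard (.ite e P Q))) α N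
  | parLeft {M M' N : Net} {α : Act} (hs : Fire F D Γ t M α M') :
      Fire F D Γ t (.par M N) α (.par M' N)
  | parRight {M M' N : Net} {α : Act} (hs : Fire F D Γ t M α M') :
      Fire F D Γ t (.par N M) α (.par N M')
  | com {M M' N N' : Net} {α : Act} (hα : α ≠ .tau) (hM : Fire F D Γ t M α M')
      (hN : Fire F D Γ t N α.co N') : Fire F D Γ t (.par M N) .tau (.par M' N')
  | res {M M' : Net} {a : Chan} {α : Act} (hs : Fire F D Γ t M α M')
      (hα : ∀ v : Val, α ≠ .out a v ∧ α ≠ .inp a v) :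
      Fire F D Γ t (.res M a) α (.res M' a)

section Simulation

variable {F : DataFn → Val → Val} {D : ProcDefs} {Γ : Ctx} {t : ℕ}

theorem Val.nat_injective {j k : ℕ} (h : Val.nat j = Val.nat k) : j = k := by
  have := congrArg Val.nat? h
  simpa using this

theorem Fire.live {ℓ : Loc} {P : Proc} {α : Act} {N : Net}
    (h : Fire F D Γ t (.loc ℓ P) α N) : Γ.Live ℓ := by
  cases h <;> assumption

variable (F D Γ t) in
/-- `N` can match every transition of `M`, up to structural congruence of the results. -/
def Simulates (M N : Net) : Prop :=
  ∀ α M', Fire F D Γ t M α M' → ∃ N', Fire F D Γ t N α N' ∧ NetCong F D Γ M' N'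

namespace Simulates

theorem of_imp {M N : Net} (h : ∀ α M', Fire F D Γ t M α M' → Fire F D Γ t N α M') :
    Simulates F D Γ t M N := fun α M' hM => ⟨M', h α M' hM, .refl _⟩

theorem trans {M N O : Net} (h : Simulates F D Γ t M N) (h' : Simulates F D Γ t N O) :
    Simulates F D Γ t M O := by
  intro α M' hM
  obtain ⟨N', hN, e⟩ := h α M' hM
  obtain ⟨O', hO, e'⟩ := h' α N' hN
  exact ⟨O', hO, e.trans e'⟩

theorem par {M M' N N' : Net} (hM : Simulates F D Γ t M M') (hN : Simulates F D Γ t N N')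
    (eM : NetCong F D Γ M M') (eN : NetCong F D Γ N N') :
    Simulates F D Γ t (.par M N) (.par M' N') := by
  intro α O h
  cases h with
  | parLeft hs =>
    obtain ⟨_, h1, e1⟩ := hM _ _ hs
    exact ⟨_, .parLeft h1, .par e1 eN⟩
  | parRight hs =>
    obtain ⟨_, h1, e1⟩ := hN _ _ hs
    exact ⟨_, .parRight h1, .par eM e1⟩
  | com hα h h' =>
    obtain ⟨_, h1, e1⟩ := hM _ _ h
    obtain ⟨_, h2, e2⟩ := hN _ _ h'
    exact ⟨_, .com hα h1 h2, .par e1 e2⟩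

theorem res {M M' : Net} (a : Chan) (hM : Simulates F D Γ t M M') :
    Simulates F D Γ t (.res M a) (.res M' a) := by
  intro α O h
  cases h with
  | res hs hα =>
    obtain ⟨_, h1, e1⟩ := hM _ _ hs
    exact ⟨_, .res h1 hα, .res e1⟩

theorem parComm (M N : Net) : Simulates F D Γ t (.par M N) (.par N M) := by
  intro α O h
  cases h with
  | parLeft hs => exact ⟨_, .parRight hs, .parComm _ _⟩
  | parRight hs => exact ⟨_, .parLeft hs, .parComm _ _⟩
  | com hα h h' =>
    exact ⟨_, .com (Act.co_ne_tau hα) h' (by rwa [Act.co_co]), .parComm _ _⟩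

theorem parAssoc (M N O : Net) :
    Simulates F D Γ t (.par (.par M N) O) (.par M (.par N O)) := by
  intro α Q h
  cases h with
  | parLeft hs =>
    cases hs with
    | parLeft hs => exact ⟨_, .parLeft hs, .parAssoc _ _ _⟩
    | parRight hs => exact ⟨_, .parRight (.parLeft hs), .parAssoc _ _ _⟩
    | com hα h h' => exact ⟨_, .com hα h (.parLeft h'), .parAssoc _ _ _⟩
  | parRight hs => exact ⟨_, .parRight (.parRight hs), .parAssoc _ _ _⟩
  | com hα h h' =>
    cases h with
    | parLeft hs => exact ⟨_, .com hα hs (.parRight h'), .parAssoc _ _ _⟩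
    | parRight hs => exact ⟨_, .parRight (.com hα hs h'), .parAssoc _ _ _⟩
    | com => exact absurd rfl hα

theorem parAssoc' (M N O : Net) :
    Simulates F D Γ t (.par M (.par N O)) (.par (.par M N) O) :=
  (parComm _ _).trans ((parAssoc _ _ _).trans ((parComm _ _).trans
    ((parAssoc _ _ _).trans (parComm _ _))))

theorem parNil (M : Net) : Simulates F D Γ t (.par M .nil) M := by
  intro α Q h
  cases h with
  | parLeft hs => exact ⟨_, hs, .parNil _⟩
  | parRight hs => cases hs
  | com _ _ h' => cases h'

theorem parNil' (M : Net) : Simulates F D Γ t M (.par M .nil) :=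
  fun _ _ h => ⟨_, .parLeft h, (NetCong.parNil _).symm⟩

end Simulates

theorem Eval.simulates {M N : Net} (h : Eval F D Γ M N) :
    Simulates F D Γ t M N ∧ Simulates F D Γ t N M := by
  induction h with
  | split h =>
    refine ⟨.of_imp fun α M' hM => ?_, .of_imp fun α M' hM => .split h hM⟩
    cases hM with
    | split _ hs => exact hs
  | locNil h =>
    refine ⟨.of_imp fun α M' hM => ?_, .of_imp fun α M' hM => ?_⟩ <;> cases hM
  | dead h =>
    refine ⟨.of_imp fun α M' hM => absurd hM.live h, .of_imp fun α M' hM => ?_⟩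
    cases hM
  | nilLeft =>
    exact ⟨(Simulates.parComm _ _).trans (.parNil _), (Simulates.parNil' _).trans (.parComm _ _)⟩
  | nilRight => exact ⟨.parNil _, .parNil' _⟩
  | outEval h he =>
    refine ⟨.of_imp fun α M' hM => ?_, .of_imp fun α M' hM => ?_⟩
    · cases hM with
      | snd _ he' => rw [he] at he'; cases he'; exact .snd h rfl
    · cases hM with
      | snd _ he' => cases he'; exact .snd h he
  | expand h hK he hσ =>
    refine ⟨.of_imp fun α M' hM => ?_, .of_imp fun α M' hM => .expand h hK he hσ hM⟩
    cases hM with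
    | expand _ hK' he' hσ' hs =>
      rw [hK] at hK'; cases hK'
      rw [he] at he'; cases he'
      rw [hσ] at hσ'; cases hσ'
      exact hs
  | iteTrue h he hk =>
    refine ⟨.of_imp fun α M' hM => ?_, .of_imp fun α M' hM => .iteTrue h he hk hM⟩
    cases hM with
    | iteTrue _ _ _ hs => exact hs
    | iteFalse _ he' hs =>
      rw [he] at he'
      exact absurd (Val.nat_injective (Option.some.inj he')) hk.ne'
  | iteFalse h he =>
    refine ⟨.of_imp fun α M' hM => ?_, .of_imp fun α M' hM => .iteFalse h he hM⟩
    cases hM with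
    | iteTrue _ he' hk hs =>
      rw [he] at he'
      exact absurd (Val.nat_injective (Option.some.inj he')) hk.ne
    | iteFalse _ _ hs => exact hs
  | parLeft h ih =>
    exact ⟨.par ih.1 (.of_imp fun _ _ h => h) (.eval h) (.refl _),
      .par ih.2 (.of_imp fun _ _ h => h) (.symm (.eval h)) (.refl _)⟩
  | parRight h ih =>
    exact ⟨.par (.of_imp fun _ _ h => h) ih.1 (.refl _) (.eval h),
      .par (.of_imp fun _ _ h => h) ih.2 (.refl _) (.symm (.eval h))⟩
  | res _ ih => exact ⟨.res _ ih.1, .res _ ih.2⟩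

/-- Structural congruence is a bisimulation for the transitions that evaluate on demand. -/
theorem NetCong.simulates {M N : Net} (h : NetCong F D Γ M N) :
    Simulates F D Γ t M N ∧ Simulates F D Γ t N M := by
  induction h with
  | refl M => exact ⟨.of_imp fun _ _ h => h, .of_imp fun _ _ h => h⟩
  | symm _ ih => exact ih.symm
  | trans _ _ ih ih' => exact ⟨ih.1.trans ih'.1, ih'.2.trans ih.2⟩
  | eval h => exact h.simulates
  | parComm M N => exact ⟨.parComm _ _, .parComm _ _⟩
  | parAssoc M N O => exact ⟨.parAssoc _ _ _, .parAssoc' _ _ _⟩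
  | parNil M => exact ⟨.parNil _, .parNil' _⟩
  | par h h' ih ih' => exact ⟨.par ih.1 ih'.1 h h', .par ih.2 ih'.2 h.symm h'.symm⟩
  | res _ ih => exact ⟨.res _ ih.1, .res _ ih.2⟩

/-- Before the trusted immortal is chosen, the only transition is that choice. -/
theorem Step.of_ti_none {C C' : Config} {α : Act} (h : Step F D C α C') (hC : C.ti = none) :
    α = .tau ∧ C'.ctx = C.ctx ∧ (∃ t : ℕ, C'.ti = some t) ∧
      NetCong F D C.ctx C.net C'.net := by
  induction h with
  | chooseTi => exact ⟨rfl, rfl, ⟨_, rfl⟩, .refl _⟩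
  | red h hs h' ih =>
    obtain ⟨h1, h2, h3⟩ := h
    obtain ⟨h1', h2', h3'⟩ := h'
    obtain ⟨i1, i2, ⟨s, i3⟩, i4⟩ := ih (h2 ▸ hC)
    refine ⟨i1, by rw [← h1', i2, h1], ⟨s, h2' ▸ i3⟩, h3.trans ?_⟩
    rw [i2, ← h1] at h3'
    rw [← h1] at i4
    exact i4.trans h3'
  | _ => cases hC

/-- Once the trusted immortal is chosen, a transition is, up to structural congruence, a crash or
a transition that evaluates on demand. Of a crash it is recorded that the live set shrinks and that
the budget drops; the latter rules out crashes in the premises of choice and communication, which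
leave the context unchanged. -/
theorem Step.of_ti_some {C C' : Config} {α : Act} {t : ℕ} (h : Step F D C α C')
    (hC : C.ti = some t) :
    C'.ti = some t ∧
      ((C'.ctx = C.ctx ∧ ∃ N, Fire F D C.ctx t C.net α N ∧ NetCong F D C.ctx N C'.net) ∨
        (C'.ctx.live ⊆ C.ctx.live ∧ C'.ctx.budget < C.ctx.budget ∧
          NetCong F D C'.ctx C.net C'.net)) := by
  induction h with
  | chooseTi => cases hC
  | crash hk hL => exact ⟨hC, .inr ⟨Finset.erase_subset _ _, Nat.lt_succ_self _, .refl _⟩⟩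
  | psusp h hk => cases hC; exact ⟨rfl, .inl ⟨rfl, _, .psusp h hk, .refl _⟩⟩
  | susp h ht hk => cases hC; exact ⟨rfl, .inl ⟨rfl, _, .susp h ht hk, .refl _⟩⟩
  | tau h => cases hC; exact ⟨rfl, .inl ⟨rfl, _, .tau h, .refl _⟩⟩
  | sumLeft h hs ih =>
    obtain ⟨i1, ⟨_, N, hN, e⟩ | ⟨_, h2, _⟩⟩ := ih hC
    · exact ⟨i1, .inl ⟨rfl, N, .sumLeft h hN, e⟩⟩
    · exact absurd h2 (lt_irrefl _)
  | sumRight h hs ih =>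
    obtain ⟨i1, ⟨_, N, hN, e⟩ | ⟨_, h2, _⟩⟩ := ih hC
    · exact ⟨i1, .inl ⟨rfl, N, .sumRight h hN, e⟩⟩
    · exact absurd h2 (lt_irrefl _)
  | par hs ih =>
    obtain ⟨i1, ⟨h1, N, hN, e⟩ | ⟨h1, h2, e⟩⟩ := ih hC
    · exact ⟨i1, .inl ⟨h1, _, .parLeft hN, e.parLeft _⟩⟩
    · exact ⟨i1, .inr ⟨h1, h2, e.parLeft _⟩⟩
  | snd h => cases hC; exact ⟨rfl, .inl ⟨rfl, _, .snd h rfl, .refl _⟩⟩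
  | rcv h hσ => cases hC; exact ⟨rfl, .inl ⟨rfl, _, .rcv h hσ, .refl _⟩⟩
  | com hα hM hN ihM ihN =>
    obtain ⟨i1, ⟨_, N₁, hN₁, e₁⟩ | ⟨_, h2, _⟩⟩ := ihM hC
    · obtain ⟨-, ⟨_, N₂, hN₂, e₂⟩ | ⟨_, h2, _⟩⟩ := ihN hC
      · exact ⟨i1, .inl ⟨rfl, _, .com hα hN₁ hN₂, .par e₁ e₂⟩⟩
      · exact absurd h2 (lt_irrefl _)
    · exact absurd h2 (lt_irrefl _)
  | @red C C₁ C₂ C' α h hs h' ih =>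
    obtain ⟨h1, h2, h3⟩ := h
    obtain ⟨h1', h2', h3'⟩ := h'
    rw [h2] at hC
    obtain ⟨i1, ⟨i2, N, hN, e⟩ | ⟨i2, i3, e⟩⟩ := ih hC
    · refine ⟨h2' ▸ i1, .inl ⟨by rw [← h1', i2, h1], ?_⟩⟩
      rw [i2] at h3'
      rw [h1] at h3 ⊢
      obtain ⟨N', hN', e'⟩ := h3.simulates.2 _ _ hN
      exact ⟨N', hN', e'.symm.trans (e.trans h3')⟩
    · refine ⟨h2' ▸ i1, .inr ?_⟩
      rw [h1] at h3 ⊢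
      rw [← h1']
      exact ⟨i2, i3, (h3.mono i2).trans (e.trans h3')⟩
  | res hs hα ih =>
    obtain ⟨i1, ⟨h1, N, hN, e⟩ | ⟨h1, h2, e⟩⟩ := ih hC
    · exact ⟨i1, .inl ⟨h1, _, .res hN hα, .res e⟩⟩
    · exact ⟨i1, .inr ⟨h1, h2, .res e⟩⟩

end Simulation

/-! ### Substitution and evaluation of tuples -/

section Tuples

variable {F : DataFn → Val → Val}

/-- A tuple pattern of distinct variables binds each of them to the entry at its position. -/
theorem Pat.bind_tuple {xs : List VarName} (hxs : xs.Nodup) (h0 : xs ≠ []) :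
    ∀ {vs : List Val}, xs.length = vs.length →
      (Pat.tuple xs).bind (Val.tuple vs) = some fun y => (xs.zip vs).lookup y := by
  induction xs with
  | nil => exact absurd rfl h0
  | cons x xs ih =>
    intro vs hl
    rw [List.nodup_cons] at hxs
    match xs, vs, hl with
    | [], [v], _ =>
      simp only [Pat.tuple, Val.tuple, Pat.bind, List.zip_cons_cons, List.zip_nil_left,
        Option.some.injEq]
      funext y
      by_cases h : y = x
      · simp [h]
      · have hb : (y == x) = false := by simpa using h
        simp [List.lookup_cons, h, hb]
    | x' :: xs, v :: v' :: vs, hl =>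
      have := ih hxs.2 (List.cons_ne_nil _ _) (vs := v' :: vs) (by simpa using hl)
      simp only [Pat.tuple, Val.tuple, Pat.bind, Val.unpair_pair, Option.bind_some, this,
        Option.map_some, Option.some.injEq]
      funext y
      by_cases h : y = x
      · -- `x` is not bound by the tail of the pattern
        have hn : ((x' :: xs).zip (v' :: vs)).lookup x = none := by
          rw [List.lookup_eq_none_iff]
          rintro ⟨a, b⟩ hab
          have := (List.of_mem_zip hab).1
          simp only [bne_iff_ne]
          rintro rfl
          exact hxs.1 this
        subst h
        rw [hn]
        simp
      · have hb : (y == x) = false := by simpa using h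
        have hc : ((x :: x' :: xs).zip (v :: v' :: vs)).lookup y =
            ((x' :: xs).zip (v' :: vs)).lookup y := by
          rw [List.zip_cons_cons, List.lookup_cons, hb]
        rw [hc]
        simp [h]

theorem Proc.subst_prod (σ : Subst) (l : List Proc) :
    (Proc.prod l).subst σ = Proc.prod (l.map (Proc.subst σ)) := by
  induction l with
  | nil => simp [Proc.prod, Proc.nil, Proc.subst, Guarded.subst]
  | cons P l ih =>
    simp only [Proc.prod, List.foldr_cons, Proc.subst, List.map_cons] at ih ⊢
    rw [ih]

theorem Fn.onNats_pair (g : ℕ → ℕ → ℕ) (a b : ℕ) :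
    Fn.onNats g (Val.pair (Val.nat a) (Val.nat b)) = Val.nat (g a b) := by
  simp [Fn.onNats]

theorem Fn.onVals_pair (g : Val → Val → Val) (a b : Val) :
    Fn.onVals g (Val.pair a b) = g a b := by
  simp [Fn.onVals]

theorem Expr.eval_app₂ {f : Fn} {e e' : Expr} {v v' : Val} (h : e.eval F = some v)
    (h' : e'.eval F = some v') :
    (Expr.app₂ f e e').eval F = some (f.interp F (Val.pair v v')) := by
  simp [Expr.app₂, Expr.eval, h, h']

end Tuples

/-! ### Finite products of networks -/

section Products

open Consensus

variable {F : DataFn → Val → Val} {D : ProcDefs} {Γ : Ctx} {t : ℕ}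

theorem NetCong.netProd_append (l l' : List Net) :
    NetCong F D Γ (netProd (l ++ l')) (.par (netProd l) (netProd l')) := by
  induction l with
  | nil => exact (NetCong.nilPar _).symm
  | cons M l ih => exact (ih.parRight M).trans (NetCong.parAssoc _ _ _).symm

theorem NetCong.netProd_perm {l l' : List Net} (h : l.Perm l') :
    NetCong F D Γ (netProd l) (netProd l') := by
  induction h with
  | nil => exact .refl _
  | cons M _ ih => exact ih.parRight M
  | swap M N l => exact .parLeftComm _ _ _
  | trans _ _ ih ih' => exact ih.trans ih'

theorem NetCong.loc_prod {ℓ : Loc} (h : Γ.Live ℓ) (l : List Proc) :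
    NetCong F D Γ (.loc ℓ (Proc.prod l)) (netProd (l.map (Net.loc ℓ))) := by
  induction l with
  | nil => exact .eval (.locNil h)
  | cons P l ih => exact (NetCong.eval (.split h)).trans (ih.parRight _)

/-- A call can be replaced by any other call of the same constant with an argument of the same
value. -/
theorem NetCong.call_congr {ℓ : Loc} {K : Const} {e e' : Expr} {X : Pat} {P : Proc} {v : Val}
    {σ : Subst} (h : Γ.Live ℓ) (hK : D K = some (X, P)) (hσ : X.bind v = some σ)
    (he : e.eval F = some v) (he' : e'.eval F = some v) :
    NetCong F D Γ (.loc ℓ (.call K e)) (.loc ℓ (.call K e')) :=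
  (NetCong.eval (.expand h hK he hσ)).trans (NetCong.eval (.expand h hK he' hσ)).symm

theorem NetCong.resAll (R : List Chan) {M N : Net} (h : NetCong F D Γ M N) :
    NetCong F D Γ (resAll R M) (resAll R N) := by
  induction R with
  | nil => exact h
  | cons a R ih => exact .res ih

theorem Fire.of_resAll {R : List Chan} {M O : Net} {α : Act}
    (h : Fire F D Γ t (resAll R M) α O) :
    ∃ N, Fire F D Γ t M α N ∧ O = resAll R N := by
  induction R generalizing O with
  | nil => exact ⟨O, h, rfl⟩
  | cons a R ih =>
    cases h with
    | res hs =>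
      obtain ⟨N, hN, rfl⟩ := ih hs
      exact ⟨N, hN, rfl⟩

/-- A transition of a product is a transition of one factor or a communication of two; that
the actions of the latter are complementary is not recorded. -/
theorem Fire.of_netProd {l : List Net} {α : Act} {O : Net}
    (h : Fire F D Γ t (netProd l) α O) :
    (∃ M l' N, l.Perm (M :: l') ∧ Fire F D Γ t M α N ∧ NetCong F D Γ O (.par N (netProd l'))) ∨
    (α = .tau ∧ ∃ M M' l' β β' N N', l.Perm (M :: M' :: l') ∧ Fire F D Γ t M β N ∧
      Fire F D Γ t M' β' N' ∧ NetCong F D Γ O (.par N (.par N' (netProd l')))) := by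
  induction l generalizing α O with
  | nil => cases h
  | cons M l ih =>
    cases h with
    | parLeft hs => exact .inl ⟨M, l, _, .refl _, hs, .refl _⟩
    | parRight hs =>
      obtain ⟨M₁, l', N, hp, hN, e⟩ | ⟨hα, M₁, M₂, l', β, β', N, N', hp, hN, hN', e⟩ :=
        ih hs
      · refine .inl ⟨M₁, M :: l', N, (hp.cons M).trans (.swap _ _ _), hN, ?_⟩
        exact (e.parRight M).trans (.parLeftComm _ _ _)
      · refine .inr ⟨hα, M₁, M₂, M :: l', β, β', N, N', (hp.cons M).trans ?_, hN, hN', ?_⟩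
        · exact (List.Perm.swap _ _ _).trans ((List.Perm.swap _ _ _).cons _)
        · exact (e.parRight M).trans ((NetCong.parLeftComm _ _ _).trans
            ((NetCong.parLeftComm _ _ _).parRight _))
    | com hα hM hN =>
      obtain ⟨M₁, l', N, hp, hN', e⟩ | ⟨hτ, -⟩ := ih hN
      · exact .inr ⟨rfl, M, M₁, l', _, _, _, N, hp.cons M, hM, hN', e.parRight _⟩
      · exact absurd hτ (Act.co_ne_tau hα)

end Products

namespace Consensus

/-! ### The components of the algorithm -/

section Bodies

variable {F : DataFn → Val → Val} {Γ : Ctx} {n p : ℕ}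

/-- The argument of the recursive call of `C1_p`, with `y` for the received vector. -/
def nextArgA (r : ℕ) (V M : Val) (i : ℕ) (y : Expr) : Expr :=
  .tuple [.nat r, .val V, .app₂ .insert (.tuple [y, .nat r, .nat i]) (.val M),
    .app₂ .add (.nat i) (.nat 1)]

/-- The argument of the recursive call of `C2_p`, with `y` for the received vector. -/
def nextArgB (V M : Val) (i : ℕ) (y : Expr) : Expr :=
  .tuple [.val V, .app₂ .insert (.tuple [y, .nat i]) (.val M), .app₂ .add (.nat i) (.nat 1)]

theorem bodyP1_subst (r : ℕ) (V W M : Val) :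
    (bodyP1 n p).subst (fun y => ([xr, xV, xW, xM].zip [Val.nat r, V, W, M]).lookup y) =
      .guard (.ite (.app₂ .lt (.nat r) (.nat n))
        (.par (Proc.prod ((List.range' 1 n).map fun i =>
            Proc.out (chA (.num p) (.num i) (.num r)) (.val W)))
          (.call (.C1 p) (.tuple [.nat r, .val V, .val M, .nat 1])))
        (.call (.P2 p) (.tuple [.val V, .val M]))) := by
  simp [bodyP1, Proc.subst, Guarded.subst, Expr.subst, Expr.app₂, Expr.tuple, Expr.nat,
    Proc.subst_prod, Proc.out, Proc.nil, chA, Chan.subst, Index.subst, Function.comp_def,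
    xr, xV, xW, xM, List.lookup]

theorem bodyC1_subst (r : ℕ) (V M : Val) (i : ℕ) :
    (bodyC1 n p).subst (fun y => ([xr, xV, xM, xi].zip [Val.nat r, V, M, Val.nat i]).lookup y) =
      .guard (.ite (.app₂ .le (.nat i) (.nat n))
        (.guard (.sum
          (.inp (chA (.num i) (.num p) (.num r)) (.var xy)
            (.call (.C1 p) (nextArgA r V M i (.var xy))))
          (.susp (.loc (.agent i)) (.call (.C1 p) (nextArgA r V M i (.val Val.bot))))))
        (.call (.P1 p) (.tuple [.app₂ .add (.nat r) (.nat 1),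
          .app (.data .updateKnowledge) (.tuple [.nat r, .val M, .val V]),
          .app (.data .updateReplay) (.tuple [.nat r, .val M, .val V]), .val M]))) := by
  simp [bodyC1, Proc.subst, Guarded.subst, Expr.subst, Expr.app₂, Expr.tuple, Expr.nat,
    Guarded.inpat, chA, Chan.subst, Index.subst, LocRef.subst, nextArgA, Subst.erase, Pat.vars,
    xr, xV, xM, xi, xy, List.lookup]

theorem bodyP2_subst (V M : Val) :
    (bodyP2 n p).subst (fun y => ([xV, xM].zip [V, M]).lookup y) =
      .par (Proc.prod ((List.range' 1 n).map fun i =>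
          Proc.out (chB (.num p) (.num i)) (.val V)))
        (.call (.C2 p) (.tuple [.val V, .val M, .nat 1])) := by
  simp [bodyP2, Proc.subst, Guarded.subst, Expr.subst, Expr.tuple, Expr.nat,
    Proc.subst_prod, Proc.out, Proc.nil, chB, Chan.subst, Index.subst, Function.comp_def,
    xV, xM, List.lookup]

theorem bodyC2_subst (V M : Val) (i : ℕ) :
    (bodyC2 n p).subst (fun y => ([xV, xM, xi].zip [V, M, Val.nat i]).lookup y) =
      .guard (.ite (.app₂ .le (.nat i) (.nat n))
        (.guard (.sum
          (.inp (chB (.num i) (.num p)) (.var xy)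
            (.call (.C2 p) (nextArgB V M i (.var xy))))
          (.susp (.loc (.agent i)) (.call (.C2 p) (nextArgB V M i (.val Val.bot))))))
        (.call (.P3 p) (.app (.data .correct) (.tuple [.val M, .val V])))) := by
  simp [bodyC2, Proc.subst, Guarded.subst, Expr.subst, Expr.app₂, Expr.tuple, Expr.nat,
    Guarded.inpat, chB, Chan.subst, Index.subst, LocRef.subst, nextArgB, Subst.erase, Pat.vars,
    xV, xM, xi, xy, List.lookup]

theorem bodyP3_subst (V : Val) :
    (bodyP3 p).subst (fun y => ([xV].zip [V]).lookup y) =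
      Proc.out (chC (.num p)) (.app (.data .getFirst) (.val V)) := by
  simp [bodyP3, Proc.subst, Guarded.subst, Expr.subst, Proc.out, Proc.nil, chC, Chan.subst,
    Index.subst, xV, List.lookup]

/-- The test of the wrapper on a received value `y`. -/
def accepts (v : Val) (y : Expr) : Expr :=
  .app₂ .or
    (.app₂ .and (.app₂ .eq (.val v) (.val Val.bot)) (.app .not (.app₂ .eq y (.val Val.bot))))
    (.app₂ .eq (.val v) y)

theorem bodyWrap_subst (j : ℕ) (v : Val) (b : ℕ) :
    (bodyWrap n).subst (fun y => ([xi, xv, xb].zip [Val.nat j, v, Val.nat b]).lookup y) =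
      .guard (.ite (.app₂ .eq (.nat b) (.nat 1))
        (.guard (.ite
          (.app₂ .and (.app₂ .le (.nat 1) (.nat j)) (.app₂ .le (.nat j) (.nat n)))
          (.guard (.sum
            (.psusp (.loc (.agent j))
              (.call .wrap (.tuple [.app₂ .add (.nat j) (.nat 1), .val v, .nat 1])))
            (.inp (chC (.num j)) (.var xy)
              (.guard (.ite (accepts v (.var xy))
                (.call .wrap (.tuple [.app₂ .add (.nat j) (.nat 1), .var xy, .nat 1]))
                (.call .wrap (.tuple [.nat j, .val v, .nat 0])))))))
          (.guard (.ite (.app₂ .eq (.nat j) (.nat (n + 1)))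
            (Proc.out chOk (.val Val.bot))
            Proc.nil))))
        (.call .wrap (.tuple [.nat j, .val v, .nat 0]))) := by
  simp [bodyWrap, Proc.subst, Guarded.subst, Expr.subst, Expr.app₂, Expr.tuple, Expr.nat,
    chC, chOk, Chan.subst, Index.subst, LocRef.subst, accepts, Subst.erase, Pat.vars,
    Proc.out, Proc.nil, xi, xv, xb, xy, List.lookup]

end Bodies

/-! ### The items of a configuration -/

/-- The components of the configurations of the algorithm: the messages `a_{p,i,r}⟨v⟩`,
`b_{p,i}⟨v⟩`, `c_p⟨v⟩` in transit, the collectors `C1_p(r, V, M, i)` and `C2_p(V, M, i)`, and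
the wrapper `wrap(j, v, b)`. Unlike in a standard form, each component carries its own data. -/
inductive Item : Type
  | msgA (p i r : ℕ) (v : Val)
  | msgB (p i : ℕ) (v : Val)
  | msgC (p : ℕ) (v : Val)
  | collA (p r : ℕ) (V M : Val) (i : ℕ)
  | collB (p : ℕ) (V M : Val) (i : ℕ)
  | wrapper (j : ℕ) (v : Val) (b : ℕ)

namespace Item

/-- The location of an item. -/
def site : Item → Loc
  | msgA p _ _ _ => .agent p
  | msgB p _ _ => .agent p
  | msgC p _ => .agent p
  | collA p _ _ _ _ => .agent p
  | collB p _ _ _ => .agent p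
  | wrapper _ _ _ => .star

/-- The process that an item stands for. -/
def proc : Item → Proc
  | msgA p i r v => Proc.out (chA (.num p) (.num i) (.num r)) (.val v)
  | msgB p i v => Proc.out (chB (.num p) (.num i)) (.val v)
  | msgC p v => Proc.out (chC (.num p)) (.val v)
  | collA p r V M i => .call (.C1 p) (.tuple [.nat r, .val V, .val M, .nat i])
  | collB p V M i => .call (.C2 p) (.tuple [.val V, .val M, .nat i])
  | wrapper j v b => wrapCall j v b

/-- The located process that an item stands for. -/
def net (x : Item) : Net := .loc x.site x.proc

/-- The items that a call of `P2_p(V, M)` evaluates to. -/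
def startB (n p : ℕ) (V M : Val) : List Item :=
  (List.range' 1 n).map (fun i => msgB p i V) ++ [collB p V M 1]

/-- The items that a call of `P1_p(r, V, W, M)` evaluates to. -/
def startA (n p r : ℕ) (V W M : Val) : List Item :=
  if r < n then (List.range' 1 n).map (fun i => msgA p i r W) ++ [collA p r V M 1]
  else startB n p V M

/-- `Next n x l`: a transition can replace the item `x` by the items `l`. The relation leaves open
the data of the new items, which do not matter for the shape of a configuration. -/
inductive Next (n : ℕ) : Item → List Item → Prop
  | msgA {p i r v} : Next n (msgA p i r v) []
  | msgB {p i v} : Next n (msgB p i v) []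
  | msgC {p v} : Next n (msgC p v) []
  | collA {p r V M i M'} (hi : i < n) : Next n (collA p r V M i) [collA p r V M' (i + 1)]
  | roundA {p r V M V' W' M'} : Next n (collA p r V M n) (startA n p (r + 1) V' W' M')
  | collB {p V M i M'} (hi : i < n) : Next n (collB p V M i) [collB p V M' (i + 1)]
  | decide {p V M v} : Next n (collB p V M n) [msgC p v]
  | wrapper {j v b j' v' b'} (hj : j' ≤ n + 1) (hb : b' = 0 ∨ b' = 1) :
      Next n (wrapper j v b) [wrapper j' v' b']

/-- The side conditions on a single item, when `L` is the set of live agents. -/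
def Ok (n : ℕ) (L : Finset ℕ) : Item → Prop
  | msgA p i r _ => (p ∈ Finset.Icc 1 n ∧ p ∈ L) ∧ i ∈ Finset.Icc 1 n ∧ 1 ≤ r ∧ r < n
  | msgB p i _ => (p ∈ Finset.Icc 1 n ∧ p ∈ L) ∧ i ∈ Finset.Icc 1 n
  | msgC p _ => p ∈ Finset.Icc 1 n ∧ p ∈ L
  | collA p r _ _ i => (p ∈ Finset.Icc 1 n ∧ p ∈ L) ∧ 1 ≤ r ∧ r < n ∧ 1 ≤ i ∧ i ≤ n
  | collB p _ _ i => (p ∈ Finset.Icc 1 n ∧ p ∈ L) ∧ 1 ≤ i ∧ i ≤ n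
  | wrapper j _ b => j ≤ n + 1 ∧ (b = 0 ∨ b = 1)

end Item

/-! ### Evaluation and transitions of the items -/

section Items

variable {F : DataFn → Val → Val} {Γ : Ctx} {n p t : ℕ}

theorem congr_prod_map {ℓ : Loc} (hl : Γ.Live ℓ) (f : ℕ → Proc) (g : ℕ → Item) (l : List ℕ)
    (h : ∀ i, (g i).net = .loc ℓ (f i)) :
    NetCong F (defs n) Γ (.loc ℓ (Proc.prod (l.map f))) (netProd ((l.map g).map Item.net)) := by
  have := NetCong.loc_prod (F := F) (D := defs n) hl (l.map f)
  simpa [Function.comp_def, h] using this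

theorem congr_prod_append_singleton {ℓ : Loc} {P Q : Proc} {l : List Item} {x : Item}
    (hl : Γ.Live ℓ)
    (hP : NetCong F (defs n) Γ (.loc ℓ P) (netProd (l.map Item.net)))
    (hQ : NetCong F (defs n) Γ (.loc ℓ Q) x.net) :
    NetCong F (defs n) Γ (.loc ℓ (.par P Q)) (netProd ((l ++ [x]).map Item.net)) := by
  rw [List.map_append]
  exact (NetCong.eval (.split hl)).trans ((NetCong.par hP
    (hQ.trans (NetCong.parNil _).symm)).trans (NetCong.netProd_append _ [x.net]).symm)

theorem eval_le (i k : ℕ) : (Expr.app₂ .le (.nat i) (.nat k)).eval F =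
    some (Val.nat (if i ≤ k then 1 else 0)) := by
  rw [Expr.eval_app₂ rfl rfl, Fn.interp, Fn.onNats_pair]

theorem eval_lt (i k : ℕ) : (Expr.app₂ .lt (.nat i) (.nat k)).eval F =
    some (Val.nat (if i < k then 1 else 0)) := by
  rw [Expr.eval_app₂ rfl rfl, Fn.interp, Fn.onNats_pair]

theorem eval_add (i k : ℕ) : (Expr.app₂ .add (.nat i) (.nat k)).eval F =
    some (Val.nat (i + k)) := by
  rw [Expr.eval_app₂ rfl rfl, Fn.interp, Fn.onNats_pair]

open Classical in
theorem eval_eq {e e' : Expr} {v v' : Val} (h : e.eval F = some v) (h' : e'.eval F = some v') :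
    (Expr.app₂ .eq e e').eval F = some (Val.nat (if v = v' then 1 else 0)) := by
  rw [Expr.eval_app₂ h h', Fn.interp, Fn.onVals_pair, apply_ite Val.nat]

theorem eval_eq_nat (i k : ℕ) : (Expr.app₂ .eq (.nat i) (.nat k)).eval F =
    some (Val.nat (if i = k then 1 else 0)) := by
  rw [eval_eq rfl rfl]
  congr 3
  exact propext ⟨Val.nat_injective, congrArg _⟩

theorem eval_ite_of {ℓ : Loc} (hl : Γ.Live ℓ) {e : Expr} {P Q : Proc} {c : Prop} [Decidable c]
    (he : e.eval F = some (Val.nat (if c then 1 else 0))) (hc : c) :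
    NetCong F (defs n) Γ (.loc ℓ (.guard (.ite e P Q))) (.loc ℓ P) :=
  .eval (.iteTrue hl (by rw [he, if_pos hc]) one_pos)

theorem eval_ite_of_not {ℓ : Loc} (hl : Γ.Live ℓ) {e : Expr} {P Q : Proc} {c : Prop}
    [Decidable c] (he : e.eval F = some (Val.nat (if c then 1 else 0))) (hc : ¬ c) :
    NetCong F (defs n) Γ (.loc ℓ (.guard (.ite e P Q))) (.loc ℓ Q) :=
  .eval (.iteFalse hl (by rw [he, if_neg hc]))

theorem call_P2 (hp : 1 ≤ p ∧ p ≤ n) (hl : Γ.Live (.agent p)) {e : Expr} {V M : Val}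
    (he : e.eval F = some (Val.tuple [V, M])) :
    NetCong F (defs n) Γ (.loc (.agent p) (.call (.P2 p) e))
      (netProd ((Item.startB n p V M).map Item.net)) := by
  refine (NetCong.eval (.expand hl (if_pos hp) he
    (Pat.bind_tuple (by decide) (by simp) rfl))).trans ?_
  rw [bodyP2_subst]
  exact congr_prod_append_singleton hl (congr_prod_map hl _ _ _ fun i => rfl) (.refl _)

theorem call_P1 (hp : 1 ≤ p ∧ p ≤ n) (hl : Γ.Live (.agent p)) {e : Expr} {r : ℕ} {V W M : Val}
    (he : e.eval F = some (Val.tuple [Val.nat r, V, W, M])) :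
    NetCong F (defs n) Γ (.loc (.agent p) (.call (.P1 p) e))
      (netProd ((Item.startA n p r V W M).map Item.net)) := by
  refine (NetCong.eval (.expand hl (if_pos hp) he
    (Pat.bind_tuple (by decide) (by simp) rfl))).trans ?_
  rw [bodyP1_subst, Item.startA]
  by_cases hr : r < n
  · rw [if_pos hr]
    exact (eval_ite_of hl (eval_lt r n) hr).trans
      (congr_prod_append_singleton hl (congr_prod_map hl _ _ _ fun i => rfl) (.refl _))
  · rw [if_neg hr]
    exact (eval_ite_of_not hl (eval_lt r n) hr).trans (call_P2 hp hl rfl)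

theorem call_C1 (hp : 1 ≤ p ∧ p ≤ n) (hl : Γ.Live (.agent p)) {e : Expr} {r i : ℕ} {V M : Val}
    (he : e.eval F = some (Val.tuple [Val.nat r, V, M, Val.nat i])) (hi : i ≤ n) :
    NetCong F (defs n) Γ (.loc (.agent p) (.call (.C1 p) e))
      (.loc (.agent p) (.guard (.sum
        (.inp (chA (.num i) (.num p) (.num r)) (.var xy)
          (.call (.C1 p) (nextArgA r V M i (.var xy))))
        (.susp (.loc (.agent i)) (.call (.C1 p) (nextArgA r V M i (.val Val.bot))))))) := by
  refine (NetCong.eval (.expand hl (if_pos hp) he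
    (Pat.bind_tuple (by decide) (by simp) rfl))).trans ?_
  rw [bodyC1_subst]
  exact eval_ite_of hl (eval_le i n) hi

theorem call_C2 (hp : 1 ≤ p ∧ p ≤ n) (hl : Γ.Live (.agent p)) {e : Expr} {i : ℕ} {V M : Val}
    (he : e.eval F = some (Val.tuple [V, M, Val.nat i])) (hi : i ≤ n) :
    NetCong F (defs n) Γ (.loc (.agent p) (.call (.C2 p) e))
      (.loc (.agent p) (.guard (.sum
        (.inp (chB (.num i) (.num p)) (.var xy)
          (.call (.C2 p) (nextArgB V M i (.var xy))))
        (.susp (.loc (.agent i)) (.call (.C2 p) (nextArgB V M i (.val Val.bot))))))) := by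
  refine (NetCong.eval (.expand hl (if_pos hp) he
    (Pat.bind_tuple (by decide) (by simp) rfl))).trans ?_
  rw [bodyC2_subst]
  exact eval_ite_of hl (eval_le i n) hi

theorem eval_nextArgA (r : ℕ) (V M : Val) (i : ℕ) (y : Val) :
    ∃ M', (nextArgA r V M i (.val y)).eval F =
      some (Val.tuple [Val.nat r, V, M', Val.nat (i + 1)]) :=
  ⟨_, by simp only [nextArgA, Expr.tuple, Expr.eval, eval_add]; rfl⟩

theorem eval_nextArgB (V M : Val) (i : ℕ) (y : Val) :
    ∃ M', (nextArgB V M i (.val y)).eval F = some (Val.tuple [V, M', Val.nat (i + 1)]) :=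
  ⟨_, by simp only [nextArgB, Expr.tuple, Expr.eval, eval_add]; rfl⟩

/-- The continuation of a collector of the first phase, once it has dealt with agent `i`. -/
theorem next_collA (hp : 1 ≤ p ∧ p ≤ n) (hl : Γ.Live (.agent p)) {r i : ℕ} (V M y : Val)
    (hi : i ≤ n) :
    ∃ l, Item.Next n (.collA p r V M i) l ∧
      NetCong F (defs n) Γ (.loc (.agent p) (.call (.C1 p) (nextArgA r V M i (.val y))))
        (netProd (l.map Item.net)) := by
  obtain ⟨M', he⟩ := eval_nextArgA (F := F) r V M i y
  rcases hi.lt_or_eq with hi | rfl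
  · refine ⟨_, .collA (M' := M') hi, ?_⟩
    exact (NetCong.call_congr hl (if_pos hp) (Pat.bind_tuple (by decide) (by simp) rfl) he
      rfl).trans (NetCong.parNil _).symm
  · refine ⟨_, .roundA (V' := F .updateKnowledge (Val.tuple [Val.nat r, M', V]))
      (W' := F .updateReplay (Val.tuple [Val.nat r, M', V])) (M' := M'), ?_⟩
    refine (NetCong.eval (.expand hl (if_pos hp) he
      (Pat.bind_tuple (by decide) (by simp) rfl))).trans ?_
    rw [bodyC1_subst]
    refine (eval_ite_of_not hl (eval_le _ _) (by omega)).trans (call_P1 hp hl ?_)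
    simp only [Expr.tuple, Expr.eval, eval_add]
    rfl

/-- The continuation of a collector of the second phase, once it has dealt with agent `i`. -/
theorem next_collB (hp : 1 ≤ p ∧ p ≤ n) (hl : Γ.Live (.agent p)) {i : ℕ} (V M y : Val)
    (hi : i ≤ n) :
    ∃ l, Item.Next n (.collB p V M i) l ∧
      NetCong F (defs n) Γ (.loc (.agent p) (.call (.C2 p) (nextArgB V M i (.val y))))
        (netProd (l.map Item.net)) := by
  obtain ⟨M', he⟩ := eval_nextArgB (F := F) V M i y
  rcases hi.lt_or_eq with hi | rfl
  · refine ⟨_, .collB (M' := M') hi, ?_⟩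
    exact (NetCong.call_congr hl (if_pos hp) (Pat.bind_tuple (by decide) (by simp) rfl) he
      rfl).trans (NetCong.parNil _).symm
  · refine ⟨_, .decide (v := F .getFirst (F .correct (Val.tuple [M', V]))), ?_⟩
    refine (NetCong.eval (.expand hl (if_pos hp) he
      (Pat.bind_tuple (by decide) (by simp) rfl))).trans ?_
    rw [bodyC2_subst]
    refine (eval_ite_of_not hl (eval_le _ _) (by omega)).trans ?_
    refine (NetCong.eval (.expand hl (if_pos hp) rfl
      (Pat.bind_tuple (vs := [_]) (by decide) (by simp) rfl))).trans ?_
    rw [bodyP3_subst]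
    exact (NetCong.eval (.outEval hl rfl)).trans (NetCong.parNil _).symm

end Items

section Wrapper

variable {F : DataFn → Val → Val} {Γ : Ctx} {n t : ℕ}

theorem live_star : Γ.Live .star := trivial

theorem call_wrap {e : Expr} {j b : ℕ} {v : Val}
    (he : e.eval F = some (Val.tuple [Val.nat j, v, Val.nat b])) :
    NetCong F (defs n) Γ (.loc .star (.call .wrap e)) (.loc .star (wrapCall j v b)) :=
  .call_congr live_star rfl (Pat.bind_tuple (by decide) (by simp) rfl) he rfl

theorem wrapCall_body (j : ℕ) (v : Val) (b : ℕ) :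
    NetCong F (defs n) Γ (.loc .star (wrapCall j v b)) (.loc .star ((bodyWrap n).subst
      fun y => ([xi, xv, xb].zip [Val.nat j, v, Val.nat b]).lookup y)) :=
  .eval (.expand live_star rfl rfl
    (Pat.bind_tuple (vs := [Val.nat j, v, Val.nat b]) (by decide) (by simp) rfl))

/-- The test of the wrapper has a numerical value; both outcomes lead to a wrapper, so it does not
matter which one. -/
theorem eval_accepts (v y : Val) :
    ∃ k : ℕ, (accepts v (.val y)).eval F = some (Val.nat k) := by
  classical
  have h₁ : (Expr.app .not (.app₂ .eq (.val y) (.val Val.bot))).eval F =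
      some (Val.nat (if (if y = Val.bot then 1 else 0) = 0 then 1 else 0)) := by
    rw [Expr.eval, eval_eq rfl rfl, Option.map_some, Fn.interp]
    rfl
  have h₂ := Expr.eval_app₂ (f := .and)
    (eval_eq (e := .val v) (e' := .val Val.bot) rfl rfl) h₁
  rw [Fn.interp, Fn.onNats_pair] at h₂
  have h₃ := Expr.eval_app₂ (f := .or) h₂ (eval_eq (e := .val v) (e' := .val y) rfl rfl)
  rw [Fn.interp, Fn.onNats_pair] at h₃
  exact ⟨_, h₃⟩

/-- The wrapper with counter `0` has terminated. -/
theorem wrapCall_zero (v : Val) :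
    NetCong F (defs n) Γ (.loc .star (wrapCall 0 v 1)) .nil := by
  refine (wrapCall_body _ _ _).trans ?_
  rw [bodyWrap_subst]
  refine (eval_ite_of live_star (eval_eq_nat _ _) rfl).trans ?_
  refine (eval_ite_of_not (c := 0 < (if 1 ≤ 0 then 1 else 0) ∧ 0 < (if 0 ≤ n then 1 else 0))
    live_star ?_ (by simp)).trans ?_
  · rw [Expr.eval_app₂ (eval_le _ _) (eval_le _ _), Fn.interp, Fn.onNats_pair]
  refine (eval_ite_of_not live_star (eval_eq_nat _ _) (by omega)).trans ?_
  exact .eval (.locNil live_star)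

/-- The wrapper with counter `n + 1` announces success. -/
theorem wrapCall_succ (v : Val) :
    NetCong F (defs n) Γ (.loc .star (wrapCall (n + 1) v 1))
      (.loc .star (Proc.out chOk (.val Val.bot))) := by
  refine (wrapCall_body _ _ _).trans ?_
  rw [bodyWrap_subst]
  refine (eval_ite_of live_star (eval_eq_nat _ _) rfl).trans ?_
  refine (eval_ite_of_not
    (c := 0 < (if 1 ≤ n + 1 then 1 else 0) ∧ 0 < (if n + 1 ≤ n then 1 else 0))
    live_star ?_ (by simp)).trans ?_
  · rw [Expr.eval_app₂ (eval_le _ _) (eval_le _ _), Fn.interp, Fn.onNats_pair]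
  exact eval_ite_of live_star (eval_eq_nat _ _) rfl

theorem wrapCall_mid {j : ℕ} (v : Val) (hj : 1 ≤ j) (hjn : j ≤ n) :
    NetCong F (defs n) Γ (.loc .star (wrapCall j v 1))
      (.loc .star (.guard (.sum
        (.psusp (.loc (.agent j))
          (.call .wrap (.tuple [.app₂ .add (.nat j) (.nat 1), .val v, .nat 1])))
        (.inp (chC (.num j)) (.var xy)
          (.guard (.ite (accepts v (.var xy))
            (.call .wrap (.tuple [.app₂ .add (.nat j) (.nat 1), .var xy, .nat 1]))
            (.call .wrap (.tuple [.nat j, .val v, .nat 0])))))))) := by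
  refine (wrapCall_body _ _ _).trans ?_
  rw [bodyWrap_subst]
  refine (eval_ite_of live_star (eval_eq_nat _ _) rfl).trans ?_
  refine eval_ite_of (c := 0 < (if 1 ≤ j then 1 else 0) ∧ 0 < (if j ≤ n then 1 else 0))
    live_star ?_ (by simp [hj, hjn])
  rw [Expr.eval_app₂ (eval_le _ _) (eval_le _ _), Fn.interp, Fn.onNats_pair]

/-- A wrapper with flag `0` only calls itself for ever; it has no transition. -/
theorem wrapCall_flag_zero {j : ℕ} {v : Val} {α : Act} {N : Net}
    (h : Fire F (defs n) Γ t (.loc .star (wrapCall j v 0)) α N) : False := by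
  -- The evaluation alternates between the call and its unfolding, so the induction is over
  -- both.
  generalize hM : Net.loc .star (wrapCall j v 0) = M at h
  have hM' : M = .loc .star (wrapCall j v 0) ∨ M = .loc .star ((bodyWrap n).subst
      fun y => ([xi, xv, xb].zip [Val.nat j, v, Val.nat 0]).lookup y) := .inl hM.symm
  clear hM
  rw [bodyWrap_subst] at hM'
  induction h with
  | expand h hK he hσ hs ih =>
    rcases hM' with h | h
    · cases h
      cases he
      cases hK
      have := (Pat.bind_tuple (xs := [xi, xv, xb]) (by decide) (by simp)
        (vs := [Val.nat j, v, Val.nat 0]) rfl)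
      cases hσ.symm.trans this
      exact ih (.inr (by rw [bodyWrap_subst]))
    · cases h
  | iteTrue h he hk hs ih =>
    rcases hM' with h | h
    · cases h
    · cases h
      rw [eval_eq_nat] at he
      exact hk.ne (Val.nat_injective (Option.some.inj he))
  | iteFalse h he hs ih =>
    rcases hM' with h | h
    · cases h
    · cases h
      exact ih (.inl rfl)
  | _ => rcases hM' with h | h <;> cases h

/-- Every transition of the wrapper leads to a wrapper again. -/
theorem next_wrapper {j b : ℕ} {v : Val} (hj : j ≤ n + 1) (hb : b = 0 ∨ b = 1) {α : Act} {N : Net}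
    (h : Fire F (defs n) Γ t (.loc .star (wrapCall j v b)) α N) :
    ∃ l, Item.Next n (.wrapper j v b) l ∧ NetCong F (defs n) Γ N (netProd (l.map Item.net)) := by
  suffices ∃ j' v' b', (j' ≤ n + 1 ∧ (b' = 0 ∨ b' = 1)) ∧
      NetCong F (defs n) Γ N (.loc .star (wrapCall j' v' b')) by
    obtain ⟨j', v', b', ⟨hj', hb'⟩, e⟩ := this
    exact ⟨_, .wrapper hj' hb', e.trans (NetCong.parNil _).symm⟩
  rcases hb with rfl | rfl
  · exact (wrapCall_flag_zero h).elim
  obtain rfl | hj0 := Nat.eq_zero_or_pos j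
  · obtain ⟨_, h', _⟩ := (wrapCall_zero v).simulates.1 _ _ h
    cases h'
  obtain hjn | rfl := Nat.le_or_eq_of_le_succ hj
  · obtain ⟨N', h', e⟩ := (wrapCall_mid v hj0 hjn).simulates.1 _ _ h
    cases h' with
    | sumLeft _ hs =>
      cases hs
      refine ⟨j + 1, v, 1, by omega, e.trans (call_wrap ?_)⟩
      simp only [Expr.tuple, Expr.eval, eval_add]
      rfl
    | sumRight _ hs =>
      cases hs with
      | @rcv _ _ _ _ y _ _ hσ =>
        cases hσ
        obtain ⟨k, hk⟩ := eval_accepts (F := F) v y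
        have hP : (Proc.guard (.ite (accepts v (.var xy))
              (.call .wrap (.tuple [.app₂ .add (.nat j) (.nat 1), .var xy, .nat 1]))
              (.call .wrap (.tuple [.nat j, .val v, .nat 0])))).subst
              (fun x => if x = xy then some y else none) =
            .guard (.ite (accepts v (.val y))
              (.call .wrap (.tuple [.app₂ .add (.nat j) (.nat 1), .val y, .nat 1]))
              (.call .wrap (.tuple [.nat j, .val v, .nat 0]))) := by
          simp [Proc.subst, Guarded.subst, Expr.subst, Expr.app₂, Expr.tuple, Expr.nat, accepts]
        rw [hP] at e
        obtain rfl | hk0 := Nat.eq_zero_or_pos k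
        · exact ⟨j, v, 0, by omega, e.trans (.eval (.iteFalse live_star hk))⟩
        · refine ⟨j + 1, y, 1, by omega,
            e.trans ((NetCong.eval (.iteTrue live_star hk hk0)).trans (call_wrap ?_))⟩
          simp only [Expr.tuple, Expr.eval, eval_add]
          rfl
  · obtain ⟨N', h', e⟩ := (wrapCall_succ v).simulates.1 _ _ h
    cases h'
    exact ⟨0, v, 1, by omega, e.trans (wrapCall_zero v).symm⟩

end Wrapper

/-- Every transition of an item replaces it by other items. -/
theorem Item.next_of_fire {F : DataFn → Val → Val} {Γ : Ctx} {n t : ℕ} {x : Item} {α : Act}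
    {N : Net} (hx : x.Ok n Γ.live) (h : Fire F (defs n) Γ t x.net α N) :
    ∃ l, Item.Next n x l ∧ NetCong F (defs n) Γ N (netProd (l.map Item.net)) := by
  cases x with
  | msgA => cases h; exact ⟨_, .msgA, .refl _⟩
  | msgB => cases h; exact ⟨_, .msgB, .refl _⟩
  | msgC => cases h; exact ⟨_, .msgC, .refl _⟩
  | collA p r V M i =>
    obtain ⟨⟨hp, hl⟩, -, -, -, hi⟩ := hx
    rw [Finset.mem_Icc] at hp
    have hl : Γ.Live (.agent p) := hl
    obtain ⟨N', h', e⟩ := (call_C1 hp hl rfl hi).simulates.1 _ _ h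
    suffices ∃ y, N' = .loc (.agent p) (.call (.C1 p) (nextArgA r V M i (.val y))) by
      obtain ⟨y, rfl⟩ := this
      obtain ⟨l, hn, e'⟩ := next_collA (F := F) (Γ := Γ) hp hl V M y hi
      exact ⟨l, hn, e.trans e'⟩
    cases h' with
    | sumLeft _ hs =>
      cases hs with
      | @rcv _ _ _ _ y _ _ hσ =>
        cases hσ
        exact ⟨y, by simp [Proc.subst, Expr.subst, nextArgA, Expr.tuple, Expr.app₂, Expr.nat]⟩
    | sumRight _ hs => cases hs; exact ⟨_, rfl⟩
  | collB p V M i =>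
    obtain ⟨⟨hp, hl⟩, -, hi⟩ := hx
    rw [Finset.mem_Icc] at hp
    have hl : Γ.Live (.agent p) := hl
    obtain ⟨N', h', e⟩ := (call_C2 hp hl rfl hi).simulates.1 _ _ h
    suffices ∃ y, N' = .loc (.agent p) (.call (.C2 p) (nextArgB V M i (.val y))) by
      obtain ⟨y, rfl⟩ := this
      obtain ⟨l, hn, e'⟩ := next_collB (F := F) (Γ := Γ) hp hl V M y hi
      exact ⟨l, hn, e.trans e'⟩
    cases h' with
    | sumLeft _ hs =>
      cases hs with
      | @rcv _ _ _ _ y _ _ hσ =>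
        cases hσ
        exact ⟨y, by simp [Proc.subst, Expr.subst, nextArgB, Expr.tuple, Expr.app₂, Expr.nat]⟩
    | sumRight _ hs => cases hs; exact ⟨_, rfl⟩
  | wrapper j v b => exact next_wrapper hx.1 hx.2 h

/-! ### Compatibility of items -/

namespace Item

/-- The compatibility of two different items of a configuration: they have different keys, and
the data of an agent that a standard form stores only once agree. An agent has at most one
collector; while it collects in round `r` of the first phase, it has sent nothing in later rounds
and nothing in later phases. -/
def Compat : Item → Item → Prop
  | msgA p i r v, msgA p' i' r' v' => p = p' → r = r' → i ≠ i' ∧ v = v'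
  | msgB p i v, msgB p' i' v' => p = p' → i ≠ i' ∧ v = v'
  | msgC p _, msgC p' _ => p ≠ p'
  | collA p r _ _ _, msgA p' _ r' _ => p = p' → r' ≤ r
  | msgA p' _ r' _, collA p r _ _ _ => p = p' → r' ≤ r
  | collA p _ _ _ _, msgB p' _ _ => p ≠ p'
  | msgB p _ _, collA p' _ _ _ _ => p ≠ p'
  | collA p _ _ _ _, msgC p' _ => p ≠ p'
  | msgC p _, collA p' _ _ _ _ => p ≠ p'
  | collA p _ _ _ _, collA p' _ _ _ _ => p ≠ p'
  | collA p _ _ _ _, collB p' _ _ _ => p ≠ p'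
  | collB p _ _ _, collA p' _ _ _ _ => p ≠ p'
  | collB p _ _ _, collB p' _ _ _ => p ≠ p'
  | collB p V _ _, msgB p' _ v => p = p' → V = v
  | msgB p _ v, collB p' V _ _ => p = p' → V = v
  | collB p _ _ _, msgC p' _ => p ≠ p'
  | msgC p _, collB p' _ _ _ => p ≠ p'
  | wrapper _ _ _, wrapper _ _ _ => False
  | _, _ => True

theorem Compat.symm {x y : Item} (h : x.Compat y) : y.Compat x := by
  cases x <;> cases y <;> simp only [Compat] at h ⊢ <;> grind

theorem compat_of_site_ne {x y : Item} (h : x.site ≠ y.site) : x.Compat y := by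
  cases x <;> cases y <;> simp only [Compat, site, ne_eq, Loc.agent.injEq] at h ⊢ <;> grind

theorem site_of_mem_startA {n p r : ℕ} {V W M : Val} {x : Item}
    (hx : x ∈ startA n p r V W M) : x.site = .agent p := by
  rw [startA] at hx
  split at hx <;> simp only [startB, List.mem_append, List.mem_map, List.mem_singleton] at hx <;>
    rcases hx with ⟨i, -, rfl⟩ | rfl <;> rfl

theorem pairwise_startA (n p r : ℕ) (V W M : Val) : (startA n p r V W M).Pairwise Compat := by
  have hn : (List.range' 1 n).Pairwise (· ≠ ·) := List.nodup_range'
  rw [startA]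
  split
  · have hc : ∀ x ∈ (List.range' 1 n).map (fun i => msgA p i r W), ∀ y ∈ [collA p r V M 1],
        x.Compat y := by
      rintro _ hx _ hy
      obtain ⟨i, -, rfl⟩ := List.mem_map.1 hx
      rw [List.mem_singleton] at hy
      subst hy
      exact fun _ => le_rfl
    rw [List.pairwise_append, List.pairwise_map]
    exact ⟨hn.imp fun h _ _ => ⟨h, rfl⟩, List.pairwise_singleton _ _, hc⟩
  · have hc : ∀ x ∈ (List.range' 1 n).map (fun i => msgB p i V), ∀ y ∈ [collB p V M 1],
        x.Compat y := by
      rintro _ hx _ hy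
      obtain ⟨i, -, rfl⟩ := List.mem_map.1 hx
      rw [List.mem_singleton] at hy
      subst hy
      exact fun _ => rfl
    rw [startB, List.pairwise_append, List.pairwise_map]
    exact ⟨hn.imp fun h _ => ⟨h, rfl⟩, List.pairwise_singleton _ _, hc⟩

theorem ok_of_mem_startA {n p r : ℕ} {V W M : Val} {L : Finset ℕ} {x : Item}
    (hp : p ∈ Finset.Icc 1 n) (hL : p ∈ L) (hr : 1 ≤ r) (hx : x ∈ startA n p r V W M) :
    x.Ok n L := by
  have hn : 1 ≤ n := by rw [Finset.mem_Icc] at hp; omega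
  rw [startA] at hx
  split at hx <;>
    simp only [startB, List.mem_append, List.mem_map, List.mem_singleton,
      List.mem_range'_1] at hx <;>
    rcases hx with ⟨i, hi, rfl⟩ | rfl <;>
    simp only [Ok, Finset.mem_Icc] at hp ⊢ <;> grind

/-- The messages and the collector of the next round are compatible with everything that the
collector of the current round is compatible with. -/
theorem compat_of_mem_startA {n p r i : ℕ} {V W M V' M' : Val} {x z : Item}
    (hz : (collA p r V' M' i).Compat z) (hx : x ∈ startA n p (r + 1) V W M) : x.Compat z := by
  rw [startA] at hx
  split at hx <;>
    simp only [startB, List.mem_append, List.mem_map, List.mem_singleton] at hx <;>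
    rcases hx with ⟨i, -, rfl⟩ | rfl <;>
    cases z <;> simp only [Compat] at hz ⊢ <;> grind

namespace Next

variable {n : ℕ} {x : Item} {l : List Item}

theorem ok {L : Finset ℕ} (h : Next n x l) (hx : x.Ok n L) : ∀ y ∈ l, y.Ok n L := by
  cases h with
  | roundA => exact fun y hy => ok_of_mem_startA hx.1.1 hx.1.2 (by omega) hy
  | _ =>
    simp only [Ok, List.mem_singleton, forall_eq, List.not_mem_nil] at hx ⊢
    grind

theorem pairwise (h : Next n x l) : l.Pairwise Compat := by
  cases h with
  | roundA => exact pairwise_startA _ _ _ _ _ _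
  | _ => simp

theorem compat {z : Item} (h : Next n x l) (hz : x.Compat z) : ∀ y ∈ l, y.Compat z := by
  cases h with
  | roundA => exact fun y hy => compat_of_mem_startA hz hy
  | _ =>
    cases z <;>
    simp only [Compat, List.mem_singleton, forall_eq, List.not_mem_nil] at hz ⊢ <;> grind

end Next

end Item

/-! ### The invariant -/

/-- The invariant of the items of a reachable configuration with live agents `L`. -/
structure Inv (n : ℕ) (L : Finset ℕ) (l : List Item) : Prop where
  ok : ∀ x ∈ l, x.Ok n L
  pairwise : l.Pairwise Item.Compat
  wrapper : ∃ j v b, Item.wrapper j v b ∈ l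

namespace Inv

variable {n : ℕ} {L : Finset ℕ} {l l' : List Item}

theorem perm (h : Inv n L l) (hp : l.Perm l') : Inv n L l' where
  ok x hx := h.ok x (hp.mem_iff.2 hx)
  pairwise := hp.pairwise h.pairwise fun h => h.symm
  wrapper := by
    obtain ⟨j, v, b, hw⟩ := h.wrapper
    exact ⟨j, v, b, hp.mem_iff.1 hw⟩

theorem next {x : Item} {xs : List Item} (h : Inv n L (x :: l)) (hx : Item.Next n x xs) :
    Inv n L (xs ++ l) where
  ok y hy := by
    rcases List.mem_append.1 hy with hy | hy
    · exact hx.ok (h.ok x (by simp)) y hy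
    · exact h.ok y (by simp [hy])
  pairwise := by
    obtain ⟨h1, h2⟩ := List.pairwise_cons.1 h.pairwise
    exact List.pairwise_append.2 ⟨hx.pairwise, h2, fun y hy z hz => hx.compat (h1 z hz) y hy⟩
  wrapper := by
    obtain ⟨j, v, b, hw⟩ := h.wrapper
    rcases List.mem_cons.1 hw with rfl | hw
    · cases hx
      exact ⟨_, _, _, List.mem_append_left _ (List.mem_singleton_self _)⟩
    · exact ⟨j, v, b, List.mem_append_right _ hw⟩

end Inv

/-- `C` is, up to structural congruence, a product of items that satisfy the invariant, and the
trusted immortal has been chosen. -/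
def Tame (F : DataFn → Val → Val) (n : ℕ) (C : Config) : Prop :=
  (∃ t : ℕ, C.ti = some t) ∧ ∃ l : List Item, Inv n C.ctx.live l ∧
    NetCong F (defs n) C.ctx C.net (resAll (restricted n) (netProd (l.map Item.net)))

section Preservation

variable {F : DataFn → Val → Val} {n : ℕ}

theorem congr_append {Γ : Ctx} {N : Net} {l l' : List Item}
    (h : NetCong F (defs n) Γ N (netProd (l.map Item.net))) :
    NetCong F (defs n) Γ (.par N (netProd (l'.map Item.net)))
      (netProd ((l ++ l').map Item.net)) := by
  rw [List.map_append]
  exact (h.parLeft _).trans (NetCong.netProd_append _ _).symm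

theorem exists_perm_cons_of_map {l : List Item} {M : Net} {k : List Net}
    (h : (l.map Item.net).Perm (M :: k)) :
    ∃ x l', l.Perm (x :: l') ∧ x.net = M ∧ (l'.map Item.net).Perm k := by
  have hM : M ∈ l.map Item.net := h.mem_iff.2 (by simp)
  obtain ⟨x, hx, rfl⟩ := List.mem_map.1 hM
  obtain ⟨s, t, rfl⟩ := List.append_of_mem hx
  refine ⟨x, s ++ t, List.perm_middle, rfl, ?_⟩
  exact (((List.perm_middle (a := x) (l₁ := s) (l₂ := t)).map Item.net).symm.trans h).cons_inv

/-- A transition of a product of items that satisfy the invariant leads to such a product. -/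
theorem Inv.fire {Γ : Ctx} {t : ℕ} {l : List Item} {α : Act} {N : Net}
    (hl : Inv n Γ.live l) (h : Fire F (defs n) Γ t (netProd (l.map Item.net)) α N) :
    ∃ l', Inv n Γ.live l' ∧ NetCong F (defs n) Γ N (netProd (l'.map Item.net)) := by
  obtain ⟨M, k, O, hp, hO, e⟩ | ⟨-, M, M', k, β, β', O, O', hp, hO, hO', e⟩ := h.of_netProd
  · obtain ⟨x, l', hp', rfl, hk⟩ := exists_perm_cons_of_map hp
    have hl' := hl.perm hp'
    obtain ⟨xs, hx, ex⟩ := Item.next_of_fire (hl'.ok x (by simp)) hO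
    exact ⟨xs ++ l', hl'.next hx,
      (e.trans ((NetCong.netProd_perm hk).symm.parRight _)).trans (congr_append ex)⟩
  · obtain ⟨x, l', hp', rfl, hk⟩ := exists_perm_cons_of_map hp
    obtain ⟨x', l'', hp'', rfl, hk'⟩ := exists_perm_cons_of_map hk
    have hl' := hl.perm (hp'.trans (hp''.cons x))
    obtain ⟨xs, hx, ex⟩ := Item.next_of_fire (hl'.ok x (by simp)) hO
    obtain ⟨xs', hx', ex'⟩ := Item.next_of_fire (hl'.ok x' (by simp)) hO'
    refine ⟨xs' ++ (xs ++ l''), ((hl'.next hx).perm List.perm_middle).next hx', ?_⟩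
    refine (e.trans (NetCong.parLeftComm _ _ _)).trans (NetCong.trans ?_ (congr_append ex'))
    exact (((NetCong.netProd_perm hk').symm.parRight _).trans (congr_append ex)).parRight _

open Classical in
/-- Items of agents that have crashed vanish. -/
theorem congr_filter_live (Γ : Ctx) (l : List Item) :
    NetCong F (defs n) Γ (netProd (l.map Item.net))
      (netProd ((l.filter fun x => Γ.Live x.site).map Item.net)) := by
  induction l with
  | nil => exact .refl _
  | cons x l ih =>
    by_cases hx : Γ.Live x.site
    · rw [List.filter_cons_of_pos (by simpa using hx)]
      exact ih.parRight _
    · rw [List.filter_cons_of_neg (by simpa using hx)]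
      exact ((NetCong.eval (.dead hx)).parLeft _).trans ((NetCong.nilPar _).trans ih)

open Classical in
theorem Inv.crash {Γ : Ctx} {L : Finset ℕ} {l : List Item} (hl : Inv n L l) :
    Inv n Γ.live (l.filter fun x => Γ.Live x.site) where
  ok x hx := by
    rw [List.mem_filter, decide_eq_true_iff] at hx
    obtain ⟨hx, hlive⟩ := hx
    have := hl.ok x hx
    cases x with
    | wrapper => exact this
    | msgC => exact ⟨this.1, hlive⟩
    | _ => exact ⟨⟨this.1.1, hlive⟩, this.2⟩
  pairwise := hl.pairwise.filter _
  wrapper := by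
    obtain ⟨j, v, b, hw⟩ := hl.wrapper
    exact ⟨j, v, b, List.mem_filter.2 ⟨hw, decide_eq_true trivial⟩⟩

theorem Tame.step {C C' : Config} {α : Act} (hC : Tame F n C) (h : Step F (defs n) C α C') :
    Tame F n C' := by
  obtain ⟨⟨t, ht⟩, l, hl, e⟩ := hC
  obtain ⟨ht', ⟨h1, N, hN, e'⟩ | ⟨h1, -, e'⟩⟩ := h.of_ti_some ht
  · obtain ⟨N', hN', e''⟩ := e.simulates.1 _ _ hN
    obtain ⟨O, hO, rfl⟩ := hN'.of_resAll
    obtain ⟨l', hl', eO⟩ := hl.fire hO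
    refine ⟨⟨t, ht'⟩, l', h1 ▸ hl', ?_⟩
    rw [h1]
    exact e'.symm.trans (e''.trans (eO.resAll _))
  · -- a crash: the items of the crashed agents are congruent to `0` and are dropped
    refine ⟨⟨t, ht'⟩, _, hl.crash (Γ := C'.ctx), ?_⟩
    exact e'.symm.trans ((e.mono h1).trans ((congr_filter_live _ l).resAll _))

/-! ### The initial configurations -/

/-- The items of the initial configuration. -/
def initItems (n : ℕ) (u : ℕ → ℕ) : List Item :=
  ((List.range' 1 n).flatMap fun p =>
    Item.startA n p 1 (initKnowledge n u p) (initReplay n u p) Val.empty) ++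
  [.wrapper 1 Val.bot 1]

theorem inv_initItems (n : ℕ) (u : ℕ → ℕ) : Inv n (Finset.Icc 1 n) (initItems n u) where
  ok x hx := by
    simp only [initItems, List.mem_append, List.mem_flatMap, List.mem_singleton,
      List.mem_range'_1] at hx
    rcases hx with ⟨p, hp, hx⟩ | rfl
    · have : p ∈ Finset.Icc 1 n := by rw [Finset.mem_Icc]; omega
      exact Item.ok_of_mem_startA this this le_rfl hx
    · exact ⟨by omega, .inr rfl⟩
  pairwise := by
    refine List.pairwise_append.2 ⟨List.pairwise_flatMap.2 ⟨fun p _ =>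
      Item.pairwise_startA _ _ _ _ _ _, ?_⟩, List.pairwise_singleton _ _, ?_⟩
    · refine List.Pairwise.imp ?_ (List.nodup_range' (s := 1) (n := n))
      intro p q hpq x hx y hy
      refine Item.compat_of_site_ne ?_
      rw [Item.site_of_mem_startA hx, Item.site_of_mem_startA hy]
      simpa using hpq
    · intro x hx y hy
      obtain ⟨p, -, hx⟩ := List.mem_flatMap.1 hx
      rw [List.mem_singleton] at hy
      subst hy
      refine Item.compat_of_site_ne ?_
      rw [Item.site_of_mem_startA hx]
      simp [Item.site]
  wrapper := ⟨1, Val.bot, 1, by simp [initItems]⟩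

theorem congr_initial (u : ℕ → ℕ) :
    NetCong F (defs n) (initial n u).ctx (initial n u).net
      (resAll (restricted n) (netProd ((initItems n u).map Item.net))) := by
  refine NetCong.resAll _ ?_
  rw [initItems, List.map_append]
  refine (NetCong.par ?_ (NetCong.parNil _).symm).trans
    (NetCong.netProd_append _ [Item.net (.wrapper 1 Val.bot 1)]).symm
  have key : ∀ ps : List ℕ, (∀ p ∈ ps, p ∈ Finset.Icc 1 n) →
      NetCong F (defs n) (initial n u).ctx
        (netProd (ps.map fun i =>
          .loc (.agent i) (.call (.P1 i) (.tuple [.nat 1, .val (initKnowledge n u i),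
            .val (initReplay n u i), .val Val.empty]))))
        (netProd ((ps.flatMap fun p => Item.startA n p 1 (initKnowledge n u p)
          (initReplay n u p) Val.empty).map Item.net)) := by
    intro ps
    induction ps with
    | nil => exact fun _ => .refl _
    | cons p ps ih =>
      intro hps
      have hp := hps p (by simp)
      rw [List.flatMap_cons, List.map_append]
      have hlive : (initial n u).ctx.Live (.agent p) := hp
      exact (NetCong.par (call_P1 (Finset.mem_Icc.1 hp) hlive rfl)
        (ih fun q hq => hps q (by simp [hq]))).trans (NetCong.netProd_append _ _).symm
  refine key _ fun p hp => ?_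
  rw [List.mem_range'_1] at hp
  rw [Finset.mem_Icc]
  omega

/-- An invariant of all transition sequences: a configuration is the initial one up to structural
congruence, or tame. -/
def InitialOrTame (F : DataFn → Val → Val) (n : ℕ) (u : ℕ → ℕ) (C : Config) : Prop :=
  (C.ti = none ∧ C.ctx = (initial n u).ctx ∧
    NetCong F (defs n) (initial n u).ctx (initial n u).net C.net) ∨ Tame F n C

theorem InitialOrTame.step {u : ℕ → ℕ} {C C' : Config} {α : Act} (hC : InitialOrTame F n u C)
    (h : Step F (defs n) C α C') : InitialOrTame F n u C' := by
  rcases hC with ⟨h1, h2, h3⟩ | hC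
  · obtain ⟨-, h4, ht, h5⟩ := h.of_ti_none h1
    refine .inr ⟨ht, initItems n u, ?_, ?_⟩
    · rw [h4, h2]
      exact inv_initItems n u
    · rw [h2] at h4 h5
      rw [h4]
      exact (h3.trans h5).symm.trans (congr_initial u)
  · exact .inr (hC.step h)

theorem InitialOrTame.weakTau {u : ℕ → ℕ} {C C' : Config} (hC : InitialOrTame F n u C)
    (h : WeakTau F (defs n) C C') : InitialOrTame F n u C' := by
  induction h with
  | refl => exact hC
  | tail _ hs ih => exact ih.step hs

theorem InitialOrTame.weakSeq {u : ℕ → ℕ} {σ : List Act} {C C' : Config}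
    (hC : InitialOrTame F n u C) (h : WeakSeq F (defs n) σ C C') : InitialOrTame F n u C' := by
  induction σ generalizing C with
  | nil => exact hC.weakTau h
  | cons α σ ih =>
    obtain ⟨C₁, C₂, h1, h2, h3⟩ := h
    exact ih ((hC.weakTau h1).step h2) h3

theorem Reachable.tame {C : Config} (hC : Reachable F n C) : Tame F n C := by
  obtain ⟨⟨t, ht⟩, u, σ, -, h⟩ := hC
  have h0 : InitialOrTame F n u (initial n u) := .inl ⟨rfl, rfl, .refl _⟩
  rcases h0.weakSeq h with ⟨h1, -⟩ | h1
  · rw [h1] at ht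
    cases ht
  · exact h1

theorem weakSeq_step {D : ProcDefs} {σ : List Act} {C C' C'' : Config}
    (h : WeakSeq F D σ C C') (hs : Step F D C' .tau C'') : WeakSeq F D σ C C'' := by
  induction σ generalizing C with
  | nil => exact Relation.ReflTransGen.tail h hs
  | cons α σ ih =>
    obtain ⟨C₁, C₂, h1, h2, h3⟩ := h
    exact ⟨C₁, C₂, h1, h2, ih h3⟩

theorem Reachable.step {C C' : Config} (hC : Reachable F n C) (h : Step F (defs n) C .tau C') :
    Reachable F n C' := by
  obtain ⟨⟨t, ht⟩, u, σ, hσ, hw⟩ := hC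
  exact ⟨⟨t, (h.of_ti_some ht).1⟩, u, σ, hσ, weakSeq_step hw h⟩

end Preservation

/-! ### Standard forms from items -/

namespace Item

/-- The data that an item carries are those that the standard form stores for it. -/
def Agrees (S : StdForm) : Item → Prop
  | msgA p _ r v => S.W p r = v
  | msgB p _ v => S.V2 p = v
  | msgC p v => S.V3 p = v
  | collA p _ V M i => S.V1 p = V ∧ S.M1 p = M ∧ S.I1 p = i
  | collB p V M i => S.V2 p = V ∧ S.M2 p = M ∧ S.I2 p = i
  | wrapper j v b => S.wj = j ∧ S.ww = v ∧ S.wb = b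

/-- The index of an item in `StdForm.out1`. -/
def keyMsgA : Item → Option (ℕ × ℕ × ℕ)
  | msgA p i r _ => some (p, i, r)
  | _ => none

/-- The index of an item in `StdForm.out2`. -/
def keyMsgB : Item → Option (ℕ × ℕ)
  | msgB p i _ => some (p, i)
  | _ => none

/-- The index of an item in `StdForm.out3`. -/
def keyMsgC : Item → Option ℕ
  | msgC p _ => some p
  | _ => none

/-- The index of an item in `StdForm.col1`. -/
def keyCollA : Item → Option (ℕ × ℕ)
  | collA p r _ _ _ => some (p, r)
  | _ => none

/-- The index of an item in `StdForm.col2`. -/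
def keyCollB : Item → Option ℕ
  | collB p _ _ _ => some p
  | _ => none

theorem keyMsgA_eq {x : Item} {p i r : ℕ} :
    x.keyMsgA = some (p, i, r) ↔ ∃ v, x = msgA p i r v := by
  cases x <;> simp [keyMsgA]

theorem keyMsgB_eq {x : Item} {p i : ℕ} :
    x.keyMsgB = some (p, i) ↔ ∃ v, x = msgB p i v := by
  cases x <;> simp [keyMsgB]

theorem keyMsgC_eq {x : Item} {p : ℕ} :
    x.keyMsgC = some p ↔ ∃ v, x = msgC p v := by
  cases x <;> simp [keyMsgC]

theorem keyCollA_eq {x : Item} {p r : ℕ} :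
    x.keyCollA = some (p, r) ↔ ∃ V M i, x = collA p r V M i := by
  cases x <;> simp [keyCollA]

theorem keyCollB_eq {x : Item} {p : ℕ} :
    x.keyCollB = some p ↔ ∃ V M i, x = collB p V M i := by
  cases x <;> simp [keyCollB]

/-- Compatible items have different keys. -/
theorem nodup_filterMap {β : Type} {l : List Item} (hl : l.Pairwise Compat)
    (key : Item → Option β)
    (h : ∀ x y b, x.Compat y → key x = some b → key y = some b → False) :
    (l.filterMap key).Nodup := by
  rw [List.Nodup, List.pairwise_filterMap]
  refine hl.imp fun {x y} hxy b hb b' hb' e => ?_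
  subst e
  exact h x y b hxy hb hb'

end Item

/-- A relation that determines its second argument is the graph of a function where it is
defined. -/
theorem exists_function {ι β : Type} [Nonempty β] {R : ι → β → Prop}
    (h : ∀ i b b', R i b → R i b' → b = b') : ∃ f : ι → β, ∀ i b, R i b → f i = b := by
  classical
  refine ⟨fun i => if hi : ∃ b, R i b then hi.choose else Classical.arbitrary β, fun i b hb => ?_⟩
  have hi : ∃ b, R i b := ⟨b, hb⟩
  simp only [dif_pos hi]
  exact h i _ _ hi.choose_spec hb

/-- Items that satisfy the invariant are those of a standard form. -/
theorem Inv.exists_agrees {n : ℕ} {L : Finset ℕ} {l : List Item} (hl : Inv n L l) (Γ : Ctx)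
    (t : ℕ) :
    ∃ S : StdForm, S.ctx = Γ ∧ S.ti = t ∧ S.out1 = l.filterMap Item.keyMsgA ∧
      S.out2 = l.filterMap Item.keyMsgB ∧ S.out3 = l.filterMap Item.keyMsgC ∧
      S.col1 = l.filterMap Item.keyCollA ∧ S.col2 = l.filterMap Item.keyCollB ∧
      ∀ x ∈ l, x.Agrees S := by
  have : Nonempty Val := ⟨Val.bot⟩
  have : Std.Symm Item.Compat := ⟨fun _ _ h => h.symm⟩
  have two : ∀ x ∈ l, ∀ y ∈ l, x = y ∨ x.Compat y := fun x hx y hy =>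
    (em (x = y)).imp_right fun hxy => hl.pairwise.forall hx hy hxy
  obtain ⟨W, hW⟩ := exists_function (ι := ℕ × ℕ) (β := Val)
    (R := fun k v => ∃ i, Item.msgA k.1 i k.2 v ∈ l) (by
      rintro k v v' ⟨i, h⟩ ⟨i', h'⟩
      have := two _ h _ h'
      simp only [Item.Compat] at this
      grind)
  obtain ⟨V2, hV2⟩ := exists_function (ι := ℕ) (β := Val)
    (R := fun p v => (∃ i, Item.msgB p i v ∈ l) ∨ ∃ M i, Item.collB p v M i ∈ l) (by
      rintro p v v' (⟨i, h⟩ | ⟨M, i, h⟩) (⟨i', h'⟩ | ⟨M', i', h'⟩) <;>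
      · have := two _ h _ h'
        simp only [Item.Compat] at this
        grind)
  obtain ⟨V3, hV3⟩ := exists_function (ι := ℕ) (β := Val)
    (R := fun p v => Item.msgC p v ∈ l) (by
      rintro p v v' h h'
      have := two _ h _ h'
      simp only [Item.Compat] at this
      grind)
  obtain ⟨f, hf⟩ := exists_function (ι := ℕ) (β := Val × Val × ℕ)
    (R := fun p d => ∃ r, Item.collA p r d.1 d.2.1 d.2.2 ∈ l) (by
      rintro p ⟨V, M, i⟩ ⟨V', M', i'⟩ ⟨r, h⟩ ⟨r', h'⟩
      have := two _ h _ h'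
      simp only [Item.Compat] at this
      grind)
  obtain ⟨g, hg⟩ := exists_function (ι := ℕ) (β := Val × ℕ)
    (R := fun p d => ∃ V, Item.collB p V d.1 d.2 ∈ l) (by
      rintro p ⟨M, i⟩ ⟨M', i'⟩ ⟨V, h⟩ ⟨V', h'⟩
      have := two _ h _ h'
      simp only [Item.Compat] at this
      grind)
  obtain ⟨j, v, b, hw⟩ := hl.wrapper
  refine ⟨{ ctx := Γ, ti := t, out1 := l.filterMap Item.keyMsgA,
            out2 := l.filterMap Item.keyMsgB, out3 := l.filterMap Item.keyMsgC,
            col1 := l.filterMap Item.keyCollA, col2 := l.filterMap Item.keyCollB,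
            W := fun p r => W (p, r), V1 := fun p => (f p).1, M1 := fun p => (f p).2.1,
            I1 := fun p => (f p).2.2, V2 := V2, M2 := fun p => (g p).1, I2 := fun p => (g p).2,
            V3 := V3, wj := j, ww := v, wb := b }, rfl, rfl, rfl, rfl, rfl, rfl, rfl, ?_⟩
  intro x hx
  cases x with
  | msgA p i r v => exact hW (p, r) v ⟨i, hx⟩
  | msgB p i v => exact hV2 p v (.inl ⟨i, hx⟩)
  | msgC p v => exact hV3 p v hx
  | collA p r V M i =>
    have := hf p (V, M, i) ⟨r, hx⟩
    simp [Item.Agrees, this]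
  | collB p V M i =>
    have := hg p (M, i) ⟨V, hx⟩
    simp [Item.Agrees, this, hV2 p V (.inr ⟨M, i, hx⟩)]
  | wrapper j' v' b' =>
    have := two _ hw _ hx
    simp only [Item.Compat] at this
    simp only [Item.Agrees]
    grind

/-- A list of items other than the wrapper is sorted by the kinds of its items. -/
theorem perm_sorted (S : StdForm) (l : List Item) (hS : ∀ x ∈ l, x.Agrees S)
    (hl : ∀ j v b, Item.wrapper j v b ∉ l) :
    (l.map Item.net).Perm
      ((l.filterMap Item.keyMsgA).map (fun x =>
        .loc (.agent x.1)
          (Proc.out (chA (.num x.1) (.num x.2.1) (.num x.2.2)) (.val (S.W x.1 x.2.2)))) ++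
      ((l.filterMap Item.keyMsgB).map (fun x =>
        .loc (.agent x.1) (Proc.out (chB (.num x.1) (.num x.2)) (.val (S.V2 x.1)))) ++
      ((l.filterMap Item.keyMsgC).map (fun p =>
        .loc (.agent p) (Proc.out (chC (.num p)) (.val (S.V3 p)))) ++
      ((l.filterMap Item.keyCollA).map (fun x =>
        .loc (.agent x.1) (.call (.C1 x.1)
          (.tuple [.nat x.2, .val (S.V1 x.1), .val (S.M1 x.1), .nat (S.I1 x.1)]))) ++
      (l.filterMap Item.keyCollB).map (fun p =>
        .loc (.agent p) (.call (.C2 p)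
          (.tuple [.val (S.V2 p), .val (S.M2 p), .nat (S.I2 p)]))))))) := by
  induction l with
  | nil => simp
  | cons x l ih =>
    have ih := ih (fun y hy => hS y (by simp [hy])) fun j v b h => hl j v b (by simp [h])
    have hx := hS x (by simp)
    rw [List.map_cons]
    refine (ih.cons _).trans ?_
    cases x with
    | msgA p i r v =>
      obtain rfl := hx
      exact .refl _
    | msgB p i v =>
      obtain rfl := hx
      exact List.perm_middle.symm
    | msgC p v =>
      obtain rfl := hx
      exact (List.perm_middle.symm).trans (List.perm_middle.symm.append_left _)
    | collA p r V M i =>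
      obtain ⟨rfl, rfl, rfl⟩ := hx
      exact (List.perm_middle.symm).trans ((List.perm_middle.symm.trans
        (List.perm_middle.symm.append_left _)).append_left _)
    | collB p V M i =>
      obtain ⟨rfl, rfl, rfl⟩ := hx
      exact (List.perm_middle.symm).trans ((List.perm_middle.symm.trans
        ((List.perm_middle.symm.trans
          (List.perm_middle.symm.append_left _)).append_left _)).append_left _)
    | wrapper j v b => exact absurd (by simp) (hl j v b)

theorem NetCong.netProd_append_of {F : DataFn → Val → Val} {D : ProcDefs} {Γ : Ctx}
    {l l' : List Net} {N : Net} (h : NetCong F D Γ (netProd l') N) :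
    NetCong F D Γ (netProd (l ++ l')) (.par (netProd l) N) :=
  (NetCong.netProd_append _ _).trans (h.parRight _)

/-- A tame configuration is structurally congruent to a valid standard form. -/
theorem Tame.exists_stdForm {F : DataFn → Val → Val} {n : ℕ} {C : Config} (hC : Tame F n C) :
    ∃ S : StdForm, S.Valid n ∧ StructCong F (defs n) (S.toConfig n) C := by
  obtain ⟨⟨t, ht⟩, l, hl, e⟩ := hC
  obtain ⟨S, hctx, hti, h1, h2, h3, h4, h5, hS⟩ := hl.exists_agrees C.ctx t
  obtain ⟨j, v, b, hw⟩ := hl.wrapper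
  have hwS := hS _ hw
  have hwok := hl.ok _ hw
  refine ⟨S, ?_, hctx, by rw [ht, ← hti]; rfl, ?_⟩
  · constructor
    · rw [h1]
      refine Item.nodup_filterMap hl.pairwise _ ?_
      rintro x y ⟨p, i, r⟩ h hx hy
      obtain ⟨v, rfl⟩ := Item.keyMsgA_eq.1 hx
      obtain ⟨v', rfl⟩ := Item.keyMsgA_eq.1 hy
      exact (h rfl rfl).1 rfl
    · rw [h2]
      refine Item.nodup_filterMap hl.pairwise _ ?_
      rintro x y ⟨p, i⟩ h hx hy
      obtain ⟨v, rfl⟩ := Item.keyMsgB_eq.1 hx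
      obtain ⟨v', rfl⟩ := Item.keyMsgB_eq.1 hy
      exact (h rfl).1 rfl
    · rw [h3]
      refine Item.nodup_filterMap hl.pairwise _ ?_
      rintro x y p h hx hy
      obtain ⟨v, rfl⟩ := Item.keyMsgC_eq.1 hx
      obtain ⟨v', rfl⟩ := Item.keyMsgC_eq.1 hy
      exact h rfl
    · rw [h4]
      refine Item.nodup_filterMap hl.pairwise _ ?_
      rintro x y ⟨p, r⟩ h hx hy
      obtain ⟨V, M, i, rfl⟩ := Item.keyCollA_eq.1 hx
      obtain ⟨V', M', i', rfl⟩ := Item.keyCollA_eq.1 hy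
      exact h rfl
    · rw [h5]
      refine Item.nodup_filterMap hl.pairwise _ ?_
      rintro x y p h hx hy
      obtain ⟨V, M, i, rfl⟩ := Item.keyCollB_eq.1 hx
      obtain ⟨V', M', i', rfl⟩ := Item.keyCollB_eq.1 hy
      exact h rfl
    · intro p i r h
      rw [h1, List.mem_filterMap] at h
      obtain ⟨x, hx, hk⟩ := h
      obtain ⟨v, rfl⟩ := Item.keyMsgA_eq.1 hk
      rw [StdForm.LiveAgent, hctx]
      exact hl.ok _ hx
    · intro p i h
      rw [h2, List.mem_filterMap] at h
      obtain ⟨x, hx, hk⟩ := h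
      obtain ⟨v, rfl⟩ := Item.keyMsgB_eq.1 hk
      rw [StdForm.LiveAgent, hctx]
      exact hl.ok _ hx
    · intro p h
      rw [h3, List.mem_filterMap] at h
      obtain ⟨x, hx, hk⟩ := h
      obtain ⟨v, rfl⟩ := Item.keyMsgC_eq.1 hk
      rw [StdForm.LiveAgent, hctx]
      exact hl.ok _ hx
    · intro p r h
      rw [h4, List.mem_filterMap] at h
      obtain ⟨x, hx, hk⟩ := h
      obtain ⟨V, M, i, rfl⟩ := Item.keyCollA_eq.1 hk
      rw [StdForm.LiveAgent, hctx, (hS _ hx).2.2]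
      exact hl.ok _ hx
    · intro p h
      rw [h5, List.mem_filterMap] at h
      obtain ⟨x, hx, hk⟩ := h
      obtain ⟨V, M, i, rfl⟩ := Item.keyCollB_eq.1 hk
      rw [StdForm.LiveAgent, hctx, (hS _ hx).2.2]
      exact hl.ok _ hx
    · rw [hwS.1]
      exact hwok.1
    · rw [hwS.2.2]
      exact hwok.2
  · obtain ⟨s, s', rfl⟩ := List.append_of_mem hw
    -- the wrapper goes to the end
    have hp : (s ++ .wrapper j v b :: s').Perm (.wrapper j v b :: (s ++ s')) := List.perm_middle
    have hl' := hl.perm hp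
    have hno : ∀ j' v' b', Item.wrapper j' v' b' ∉ s ++ s' := fun j' v' b' h =>
      (List.pairwise_cons.1 hl'.pairwise).1 _ h
    have hsort := perm_sorted S (s ++ s') (fun x hx => hS x (hp.mem_iff.2 (by simp [hx]))) hno
    have hkeys : ∀ {β : Type} (key : Item → Option β), key (.wrapper j v b) = none →
        (s ++ .wrapper j v b :: s').filterMap key = (s ++ s').filterMap key := by
      intro β key hk
      rw [List.filterMap_append, List.filterMap_append, List.filterMap_cons_none hk]
    rw [hkeys _ rfl] at h1 h2 h3 h4 h5
    rw [← h1, ← h2, ← h3, ← h4, ← h5] at hsort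
    obtain ⟨rfl, rfl, rfl⟩ := hwS
    change NetCong F (defs n) S.ctx _ _
    rw [hctx]
    refine (e.trans ((NetCong.trans (NetCong.netProd_perm (hp.map Item.net)) ?_).resAll _)).symm
    refine ((NetCong.netProd_perm hsort).parRight _).trans ((NetCong.parComm _ _).trans ?_)
    refine ((NetCong.netProd_append_of (NetCong.netProd_append_of (NetCong.netProd_append_of
      (NetCong.netProd_append _ _)))).parLeft _).trans ?_
    refine (NetCong.parAssoc _ _ _).trans (NetCong.parRight _ ?_)
    refine (NetCong.parAssoc _ _ _).trans (NetCong.parRight _ ?_)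
    refine (NetCong.parAssoc _ _ _).trans (NetCong.parRight _ ?_)
    exact NetCong.parAssoc _ _ _

end Consensus

theorem mainTheorem3 (F : DataFn → Val → Val) (n : ℕ) (hn : 1 ≤ n) (C C' : Config)
    (hstep : Step F (Consensus.defs n) C Act.tau C')
    (hC : Consensus.HasNormalForm F n C) :
    Consensus.HasNormalForm F n C' := by
  obtain ⟨_, hreach, -⟩ := hC
  have hreach' := hreach.step hstep
  obtain ⟨S, hS, e⟩ := hreach'.tame.exists_stdForm
  exact ⟨S.toConfig n, hreach', ⟨S, hS, rfl⟩, e⟩
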